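/- Let $n\ge 2$ be an integer and let $\mathcal O_n$ be the Cuntz algebra, i.e. the (nonzero) unital $C^*$-algebra generated by $n$ isometries $S_1,\dots,S_n$ with $\sum_{i=1}^n S_iS_i^*=1$. For a finite word $\mu=(\mu_1,\dots,\mu_k)$ in $\{1,\dots,n\}$ put $S_\mu=S_{\mu_1}\cdots S_{\mu_k}$ (with $S_\emptyset=1$) and $|\mu|=k$. Let $\mathcal F_n$ be the norm closure of $\bigcup_{k\ge 0}\operatorname{span}\{S_\mu S_\nu^*: |\mu|=|\nu|=k\}$, let $\mathcal D_n$ (the diagonal) be the $C^*$-subalgebra of $\mathcal O_n$ generated by all projections $S_\mu S_\mu^*$, and let $\mathcal P_n$ be the set of unitaries in $\mathcal F_n$ that are finite sums of elements of the form $S_\mu S_\nu^*$ ($\mu,\nu$ finite words). Let $\lambda(\mathcal P_n)^{-1}$ be the set of $*$-automorphisms $\rho$ of $\mathcal O_n$ for which there is $u\in\mathcal P_n$ with $\rho(S_i)=uS_i$ for $i=1,\dots,n$. Let $\varphi(x)=\sum_{i=1}^n S_ixS_i^*$ be the canonical shift, which maps $\mathcal D_n$ into itself, and let $\mathfrak G$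 be the group of those $*$-automorphisms $\alpha$ of $\mathcal D_n$ for which there is an integer $m\ge 0$ such that both $\alpha\varphi^m$ and $\alpha^{-1}\varphi^m$ commute with $\varphi$ as maps on $\mathcal D_n$. Then $\lambda(\mathcal P_n)^{-1}$ is a subgroup of $\operatorname{Aut}(\mathcal O_n)$ (the restricted Weyl group of $\mathcal O_n$), every $\rho\in\lambda(\mathcal P_n)^{-1}$ restricts to an automorphism of $\mathcal D_n$ that belongs to $\mathfrak G$, and the restriction map $r:\lambda(\mathcal P_n)^{-1}\to\mathfrak G$, $r(\rho)=\rho|_{\mathcal D_n}$, is a group isomorphism. -/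

import Mathlib

namespace Cuntz

noncomputable section

variable {A : Type*} [CStarAlgebra A] {n : ℕ}

/-- `S` exhibits the unital C*-algebra `A` as the Cuntz algebra `𝒪ₙ`: the `S i` are `n` isometries
whose range projections add up to `1`, and `A` is the C*-algebra they generate. -/
structure IsCuntzAlgebra (S : Fin n → A) : Prop where
  isometry : ∀ i, star (S i) * S i = 1
  sum_range : ∑ i, S i * star (S i) = 1
  generates : (StarAlgebra.adjoin ℂ (Set.range S)).topologicalClosure = ⊤

/-- `S_μ = S_{μ₁} ⋯ S_{μ_k}` for a multi-index `μ`; the empty multi-index gives `1`. -/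
def word (S : Fin n → A) (μ : List (Fin n)) : A := (μ.map S).prod

/-- The range projection `P_μ = S_μ S_μ^*`. -/
def rangeProj (S : Fin n → A) (μ : List (Fin n)) : A := word S μ * star (word S μ)

/-- `𝓕ₙᵏ`, the span of the `S_μ S_ν^*` with `μ` and `ν` of length `k`. -/
def matrixLevel (S : Fin n → A) (k : ℕ) : Submodule ℂ A :=
  Submodule.span ℂ
    {x | ∃ μ ν : List (Fin n), μ.length = k ∧ ν.length = k ∧ x = word S μ * star (word S ν)}

/-- The core UHF-subalgebra `𝓕ₙ`, the norm closure of the union of the `𝓕ₙᵏ`. -/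
def core (S : Fin n → A) : Set A := closure (⋃ k, (matrixLevel S k : Set A))

/-- The diagonal `𝓓ₙ`, the C*-subalgebra generated by all range projections `P_μ`. -/
def diagonal (S : Fin n → A) : StarSubalgebra ℂ A :=
  (StarAlgebra.adjoin ℂ (Set.range (rangeProj S))).topologicalClosure

/-- `𝓢ₙ`, the unitaries that are finite sums of words `S_μ S_ν^*`. -/
def wordUnitaries (S : Fin n → A) : Set A :=
  {u | u ∈ unitary A ∧ ∃ (m : ℕ) (μ ν : Fin m → List (Fin n)),
    u = ∑ j, word S (μ j) * star (word S (ν j))}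

/-- `𝓟ₙ = 𝓢ₙ ∩ 𝓤(𝓕ₙ)`. -/
def permUnitaries (S : Fin n → A) : Set A := wordUnitaries S ∩ core S

/-- `λ(𝓟ₙ)⁻¹`: the *-automorphisms of `𝒪ₙ` of the form `λ_u` with `u ∈ 𝓟ₙ`, where `λ_u` is the
endomorphism determined by `λ_u (S i) = u * S i`. -/
def permAutomorphisms (S : Fin n → A) : Set (A ≃⋆ₐ[ℂ] A) :=
  {ρ | ∃ u ∈ permUnitaries S, ∀ i, ρ (S i) = u * S i}

/-- The canonical shift `φ x = ∑ i, S i * x * (S i)^*` on `𝒪ₙ`. -/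
def shift (S : Fin n → A) (x : A) : A := ∑ i, S i * x * star (S i)

theorem IsCuntzAlgebra.orthogonal {S : Fin n → A} (hS : IsCuntzAlgebra S) {i j : Fin n}
    (hij : i ≠ j) : star (S i) * S j = 0 := by
  let _ : PartialOrder A := CStarAlgebra.spectralOrder A
  have : StarOrderedRing A := CStarAlgebra.spectralOrderedRing A
  have h1 : ∑ k, star (star (S k) * S j) * (star (S k) * S j) = 1 := by
    have h : ∑ k, star (star (S k) * S j) * (star (S k) * S j)
        = star (S j) * (∑ k, S k * star (S k)) * S j := by
      simp [Finset.mul_sum, Finset.sum_mul, mul_assoc]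
    rw [h, hS.sum_range, mul_one, hS.isometry]
  rw [← Finset.add_sum_erase _ _ (Finset.mem_univ j), hS.isometry, star_one, one_mul,
    add_eq_left, Finset.sum_eq_zero_iff_of_nonneg (fun k _ => star_mul_self_nonneg _)] at h1
  exact CStarRing.star_mul_self_eq_zero_iff _ |>.1
    (h1 i (Finset.mem_erase.2 ⟨hij, Finset.mem_univ i⟩))

/-- The shift as a unital *-endomorphism of `𝒪ₙ`. -/
def shiftHom {S : Fin n → A} (hS : IsCuntzAlgebra S) : A →⋆ₐ[ℂ] A where
  toFun := shift S
  map_one' := by simp [shift, hS.sum_range]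
  map_zero' := by simp [shift]
  map_add' x y := by simp [shift, mul_add, add_mul, Finset.sum_add_distrib]
  map_mul' x y := by
    simp only [shift, Finset.sum_mul_sum]
    refine Finset.sum_congr rfl fun i _ => ?_
    rw [Finset.sum_eq_single i]
    · calc S i * (x * y) * star (S i) = S i * x * 1 * y * star (S i) := by simp [mul_assoc]
        _ = _ := by rw [← hS.isometry i]; simp only [mul_assoc]
    · intro j _ hji
      calc S i * x * star (S i) * (S j * y * star (S j))
          = S i * x * (star (S i) * S j) * y * star (S j) := by simp only [mul_assoc]
        _ = 0 := by rw [hS.orthogonal hji.symm]; simp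
    · simp
  commutes' c := by
    simp only [shift, Algebra.algebraMap_eq_smul_one, mul_smul_comm, smul_mul_assoc, mul_one,
      ← Finset.smul_sum, hS.sum_range]
  map_star' x := by simp [shift, mul_assoc]

theorem shift_mem_diagonal {S : Fin n → A} (hS : IsCuntzAlgebra S) {x : A}
    (hx : x ∈ diagonal S) : shift S x ∈ diagonal S := by
  have hcont : Continuous (shiftHom hS) := by
    change Continuous (shift S)
    unfold shift
    fun_prop
  have hle : StarAlgebra.adjoin ℂ (Set.range (rangeProj S)) ≤
      (diagonal S).comap (shiftHom hS) := by
    refine StarAlgebra.adjoin_le ?_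
    rintro _ ⟨μ, rfl⟩
    change shift S (rangeProj S μ) ∈ diagonal S
    refine sum_mem fun i _ => ?_
    have h : S i * rangeProj S μ * star (S i) = rangeProj S (i :: μ) := by
      simp [rangeProj, word, mul_assoc]
    rw [h]
    exact StarSubalgebra.le_topologicalClosure _ (StarAlgebra.subset_adjoin ℂ _ ⟨_, rfl⟩)
  have hclosed : IsClosed (((diagonal S).comap (shiftHom hS) : StarSubalgebra ℂ A) : Set A) :=
    (StarSubalgebra.isClosed_topologicalClosure _).preimage hcont
  exact StarSubalgebra.topologicalClosure_minimal hle hclosed hx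

/-- The shift restricted to the diagonal. -/
def diagShift {S : Fin n → A} (hS : IsCuntzAlgebra S) (x : diagonal S) : diagonal S :=
  ⟨shift S x, shift_mem_diagonal hS x.2⟩

theorem commute_iterate_comp {X : Type*} {f f' g : X → X} {m k : ℕ}
    (h : Function.Commute (f ∘ g^[m]) g) (h' : Function.Commute (f' ∘ g^[k]) g) :
    Function.Commute ((f ∘ f') ∘ g^[k + m]) g := by
  have key : (f ∘ f') ∘ g^[k + m] = (f ∘ g^[m]) ∘ (f' ∘ g^[k]) := by
    funext x
    simp only [Function.comp_apply, Function.iterate_add_apply]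
    exact congrArg f (h'.iterate_right m x)
  rw [key]
  exact h.comp_left h'

/-- `𝔊`: the *-automorphisms `α` of the diagonal such that, for some `m`, both `α φᵐ` and
`α⁻¹ φᵐ` commute with the shift `φ`. -/
def eventuallyCommuting {S : Fin n → A} (hS : IsCuntzAlgebra S) :
    Subgroup (diagonal S ≃⋆ₐ[ℂ] diagonal S) where
  carrier := {α | ∃ m : ℕ, Function.Commute (⇑α ∘ (diagShift hS)^[m]) (diagShift hS) ∧
    Function.Commute (⇑(α⁻¹) ∘ (diagShift hS)^[m]) (diagShift hS)}
  one_mem' := ⟨0, fun _ => rfl, fun _ => rfl⟩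
  inv_mem' := by
    rintro α ⟨m, h, h'⟩
    exact ⟨m, h', by rwa [inv_inv]⟩
  mul_mem' := by
    rintro α β ⟨m, h, h'⟩ ⟨k, l, l'⟩
    refine ⟨k + m, commute_iterate_comp (f := ⇑α) (f' := ⇑β) h l, ?_⟩
    rw [add_comm, mul_inv_rev]
    exact commute_iterate_comp (f := ⇑(β⁻¹)) (f' := ⇑(α⁻¹)) l' h'

end

end Cuntz

namespace Cuntz

noncomputable section

/-! Write `λ_u` for the endomorphism `S i ↦ u * S i` and `𝓓` for the diagonal. The proof rests on
the recursion `λ_u(S_i x S_i^*) = u S_i λ_u(x) S_i^* u^*`, which together with continuity determines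
`λ_u` on `𝓓`, and on the fact that every `u ∈ 𝓟ₙ` is a permutation of the words of some length `k`
(`exists_permElement`). Such a `u` permutes cylinder projections by conjugation and commutes with
the range of `φᵏ`.

Surjectivity. For `α ∈ 𝔊` put `β_i(y) = α(S_i α⁻¹(y) S_i^*)`. If `β_i(y) = u S_i y S_i^* u^*` on
`𝓓`, then `α` satisfies the recursion of `λ_u`, hence agrees with it on `𝓓`. That `α⁻¹φᵐ` commutes
with `φ` makes each `β_i` absorb factors from `φᵐ⁺¹(𝓓)`. The projections `β_i(P_ν)`, `|ν| = m`, then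
look like the cylinders of level `m + 1`, and counting cylinders at a finer level produces the
permutation `u` (`exists_permUnitary_of_projections`). Treating `α⁻¹` likewise gives two
endomorphisms. They are mutually inverse by a rigidity statement: a permutative endomorphism that
maps `𝓓` onto `𝓓` is determined by its restriction to `𝓓` (`eq_of_eq_on_diagonal`). Rigidity also
gives injectivity.

The restriction lies in `𝔊`. Here `ρ⁻¹ = λ_v` with `v = ρ⁻¹(u^*)`, which belongs to the core but is
not yet known to be permutative. Since `ρ(𝓓) ⊆ 𝓓`, the algebra `ρ⁻¹(𝓓)` commutes with `𝓓`, and it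
lies in the core, where `𝓓` is maximal abelian; so `ρ⁻¹(𝓓) ⊆ 𝓓`. Approximating `v` by a finite
matrix level shows that `v` commutes with `φᵏ(𝓓)` for some `k` (`exists_conj_shift_eq`), because
commuting projections at distance less than one coincide. The commutation relations follow. Closure
of the permutative automorphisms under inverses is then a consequence of surjectivity.

The existence of `λ_u` and of the gauge action needs the universality of the Cuntz algebra. It comes
from Cuntz's compression argument: averaging over the circle is faithful, and its norm is controlled
by compression in a single representation. -/

/-- `n` isometries in a unital C*-algebra whose range projections add up to `1`. -/
structure IsCuntzFamily {A : Type*} [CStarAlgebra A] {n : ℕ} (S : Fin n → A) : Prop where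
  isometry : ∀ i, star (S i) * S i = 1
  sum_range : ∑ i, S i * star (S i) = 1

/-! ### Calculus of words and of the canonical shift. -/

section Words

variable {A : Type*} [CStarAlgebra A] {n : ℕ} {S : Fin n → A}

theorem IsCuntzAlgebra.isCuntzFamily (hS : IsCuntzAlgebra S) : IsCuntzFamily S :=
  ⟨hS.isometry, hS.sum_range⟩

/-- The positive elements `(S_k^* S_j)^* (S_k^* S_j)` add up to `1`, and the term `k = j` is already
`1`, so the others vanish. -/
theorem IsCuntzFamily.orthogonal (hS : IsCuntzFamily S) {i j : Fin n}
    (hij : i ≠ j) : star (S i) * S j = 0 := by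
  let _ : PartialOrder A := CStarAlgebra.spectralOrder A
  have : StarOrderedRing A := CStarAlgebra.spectralOrderedRing A
  have h1 : ∑ k, star (star (S k) * S j) * (star (S k) * S j) = 1 := by
    have h : ∑ k, star (star (S k) * S j) * (star (S k) * S j)
        = star (S j) * (∑ k, S k * star (S k)) * S j := by
      simp [Finset.mul_sum, Finset.sum_mul, mul_assoc]
    rw [h, hS.sum_range, mul_one, hS.isometry]
  rw [← Finset.add_sum_erase _ _ (Finset.mem_univ j), hS.isometry, star_one, one_mul,
    add_eq_left, Finset.sum_eq_zero_iff_of_nonneg (fun k _ => star_mul_self_nonneg _)] at h1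
  exact CStarRing.star_mul_self_eq_zero_iff _ |>.1
    (h1 i (Finset.mem_erase.2 ⟨hij, Finset.mem_univ i⟩))

theorem IsCuntzFamily.unitary_mul (hS : IsCuntzFamily S) {u : A} (hu : u ∈ unitary A) :
    IsCuntzFamily fun i => u * S i where
  isometry i := by
    rw [star_mul, mul_assoc, ← mul_assoc (star u), Unitary.star_mul_self_of_mem hu, one_mul,
      hS.isometry]
  sum_range := by
    calc ∑ i, u * S i * star (u * S i) = u * (∑ i, S i * star (S i)) * star u := by
          simp [Finset.mul_sum, Finset.sum_mul, mul_assoc]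
      _ = 1 := by rw [hS.sum_range, mul_one, Unitary.mul_star_self_of_mem hu]

@[simp] theorem word_nil : word S [] = 1 := rfl

@[simp] theorem word_cons (i : Fin n) (μ : List (Fin n)) : word S (i :: μ) = S i * word S μ := by
  simp [word]

theorem word_append (μ ν : List (Fin n)) : word S (μ ++ ν) = word S μ * word S ν := by
  simp [word]

theorem IsCuntzFamily.star_word_mul_self (hS : IsCuntzFamily S) (μ : List (Fin n)) :
    star (word S μ) * word S μ = 1 := by
  induction μ with
  | nil => simp
  | cons i μ ih =>
    rw [word_cons, star_mul, mul_assoc, ← mul_assoc (star (S i)), hS.isometry, one_mul, ih]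

theorem IsCuntzFamily.star_word_mul_word (hS : IsCuntzFamily S) {μ ν : List (Fin n)}
    (h : μ.length = ν.length) : star (word S μ) * word S ν = if μ = ν then 1 else 0 := by
  induction μ generalizing ν with
  | nil =>
    obtain rfl : ν = [] := by simpa using h.symm
    simp
  | cons i μ ih =>
    obtain _ | ⟨j, ν⟩ := ν
    · simp at h
    · rw [word_cons, word_cons, star_mul, mul_assoc, ← mul_assoc (star (S i))]
      by_cases hij : i = j
      · subst hij
        rw [hS.isometry, one_mul, ih (by simpa using h)]
        simp
      · rw [hS.orthogonal hij]
        simp [hij]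

theorem IsCuntzFamily.shift_mul (hS : IsCuntzFamily S) (x : A) (i : Fin n) :
    shift S x * S i = S i * x := by
  rw [shift, Finset.sum_mul, Finset.sum_eq_single i]
  · rw [mul_assoc, hS.isometry, mul_one]
  · intro j _ hj
    rw [mul_assoc, hS.orthogonal hj, mul_zero]
  · simp

theorem IsCuntzFamily.star_mul_shift (hS : IsCuntzFamily S) (x : A) (i : Fin n) :
    star (S i) * shift S x = x * star (S i) := by
  rw [shift, Finset.mul_sum, Finset.sum_eq_single i]
  · rw [← mul_assoc, ← mul_assoc, hS.isometry, one_mul]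
  · intro j _ hj
    rw [← mul_assoc, ← mul_assoc, hS.orthogonal hj.symm, zero_mul, zero_mul]
  · simp

theorem IsCuntzFamily.shift_iterate_mul_word (hS : IsCuntzFamily S) (x : A) (μ : List (Fin n)) :
    (shift S)^[μ.length] x * word S μ = word S μ * x := by
  induction μ with
  | nil => simp
  | cons i μ ih =>
    rw [List.length_cons, Function.iterate_succ_apply', word_cons, ← mul_assoc, hS.shift_mul,
      mul_assoc, ih, mul_assoc]

theorem IsCuntzFamily.star_word_mul_shift_iterate (hS : IsCuntzFamily S) (x : A)
    (μ : List (Fin n)) :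
    star (word S μ) * (shift S)^[μ.length] x = x * star (word S μ) := by
  induction μ with
  | nil => simp
  | cons i μ ih =>
    rw [List.length_cons, Function.iterate_succ_apply', word_cons, star_mul, mul_assoc,
      hS.star_mul_shift, ← mul_assoc, ih, mul_assoc]

/-- A word of length `k + 1` is a letter followed by a word of length `k`. -/
def vectorConsEquiv (n k : ℕ) : Fin n × List.Vector (Fin n) k ≃ List.Vector (Fin n) (k + 1) where
  toFun p := p.1 ::ᵥ p.2
  invFun μ := (μ.head, μ.tail)
  left_inv p := by simp
  right_inv μ := by simp

theorem shift_iterate_eq_sum (S : Fin n → A) (k : ℕ) (x : A) :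
    (shift S)^[k] x = ∑ μ : List.Vector (Fin n) k, word S μ.toList * x * star (word S μ.toList) := by
  induction k with
  | zero =>
    rw [Fintype.sum_eq_single (List.Vector.nil : List.Vector (Fin n) 0)
      (fun μ h => absurd (Subsingleton.elim _ _) h)]
    simp
  | succ k ih =>
    rw [Function.iterate_succ_apply', ih, ← (vectorConsEquiv n k).sum_comp, Fintype.sum_prod_type,
      shift]
    refine Finset.sum_congr rfl fun i _ => ?_
    rw [Finset.mul_sum, Finset.sum_mul]
    refine Finset.sum_congr rfl fun μ _ => ?_
    rw [vectorConsEquiv, Equiv.coe_fn_mk, List.Vector.toList_cons, word_cons, star_mul]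
    simp only [mul_assoc]

theorem IsCuntzFamily.shift_one (hS : IsCuntzFamily S) : shift S 1 = 1 := by
  simp [shift, hS.sum_range]

theorem IsCuntzFamily.shift_iterate_one (hS : IsCuntzFamily S) (k : ℕ) : (shift S)^[k] 1 = 1 :=
  Function.iterate_fixed hS.shift_one k

theorem IsCuntzFamily.sum_rangeProj (hS : IsCuntzFamily S) (k : ℕ) :
    ∑ μ : List.Vector (Fin n) k, rangeProj S μ.toList = 1 := by
  simpa [rangeProj, shift_iterate_eq_sum] using hS.shift_iterate_one k

theorem IsCuntzFamily.star_vector_mul (hS : IsCuntzFamily S) {k : ℕ}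
    (μ ν : List.Vector (Fin n) k) :
    star (word S μ.toList) * word S ν.toList = if μ = ν then 1 else 0 := by
  rw [hS.star_word_mul_word (by simp)]
  simp only [List.Vector.toList_injective.eq_iff]

theorem IsCuntzFamily.shift_iterate_mul_vector (hS : IsCuntzFamily S) (x : A) {k : ℕ}
    (μ : List.Vector (Fin n) k) : (shift S)^[k] x * word S μ.toList = word S μ.toList * x := by
  simpa using hS.shift_iterate_mul_word x μ.toList

theorem IsCuntzFamily.shift_mul_shift (hS : IsCuntzFamily S) (x y : A) :
    shift S (x * y) = shift S x * shift S y := by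
  conv_rhs => rw [shift.eq_1 S y, Finset.mul_sum]
  rw [shift]
  refine Finset.sum_congr rfl fun i _ => ?_
  rw [← mul_assoc, ← mul_assoc, ← mul_assoc, hS.shift_mul]

theorem shift_star (S : Fin n → A) (x : A) : shift S (star x) = star (shift S x) := by
  simp [shift, mul_assoc]

theorem IsCuntzFamily.shift_iterate_mul (hS : IsCuntzFamily S) (k : ℕ) (x y : A) :
    (shift S)^[k] (x * y) = (shift S)^[k] x * (shift S)^[k] y := by
  induction k with
  | zero => rfl
  | succ k ih => simp only [Function.iterate_succ_apply', ih, hS.shift_mul_shift]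

theorem shift_iterate_star (S : Fin n → A) (k : ℕ) (x : A) :
    (shift S)^[k] (star x) = star ((shift S)^[k] x) :=
  Function.Semiconj.iterate_right (f := star) (fun x => (shift_star S x).symm) k x |>.symm

theorem shift_iterate_zero (S : Fin n → A) (k : ℕ) : (shift S)^[k] 0 = 0 :=
  Function.iterate_fixed (by simp [shift]) k

theorem rangeProj_append (S : Fin n → A) (μ ν : List (Fin n)) :
    rangeProj S (μ ++ ν) = word S μ * rangeProj S ν * star (word S μ) := by
  simp [rangeProj, word_append, mul_assoc]

theorem IsCuntzFamily.rangeProj_append_eq_mul (hS : IsCuntzFamily S) (μ ν : List (Fin n)) :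
    rangeProj S (μ ++ ν) = rangeProj S μ * (shift S)^[μ.length] (rangeProj S ν) := by
  rw [rangeProj_append, rangeProj.eq_1 S μ, mul_assoc (word S μ) (star _),
    hS.star_word_mul_shift_iterate, mul_assoc]

theorem star_rangeProj (S : Fin n → A) (μ : List (Fin n)) :
    star (rangeProj S μ) = rangeProj S μ := by
  simp [rangeProj]

theorem IsCuntzFamily.rangeProj_mul_self (hS : IsCuntzFamily S) (μ : List (Fin n)) :
    rangeProj S μ * rangeProj S μ = rangeProj S μ := by
  rw [rangeProj, mul_assoc, ← mul_assoc (star _), hS.star_word_mul_self, one_mul]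

theorem IsCuntzFamily.rangeProj_vector_mul (hS : IsCuntzFamily S) {k : ℕ}
    (μ ν : List.Vector (Fin n) k) :
    rangeProj S μ.toList * rangeProj S ν.toList = if μ = ν then rangeProj S μ.toList else 0 := by
  rw [rangeProj, rangeProj, mul_assoc, ← mul_assoc (star _), hS.star_vector_mul]
  split_ifs with h
  · rw [h, one_mul]
  · simp

theorem IsCuntzFamily.rangeProj_ne_zero [Nontrivial A] (hS : IsCuntzFamily S)
    (μ : List (Fin n)) : rangeProj S μ ≠ 0 := by
  intro h
  have h1 : star (word S μ) * rangeProj S μ * word S μ = 1 := by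
    rw [rangeProj, ← mul_assoc, hS.star_word_mul_self, one_mul, hS.star_word_mul_self]
  rw [h] at h1
  simp at h1

/-- The linear span of the words `S_μ S_ν^*`. -/
def wordSpan (S : Fin n → A) : Submodule ℂ A :=
  Submodule.span ℂ (Set.range fun p : List (Fin n) × List (Fin n) => word S p.1 * star (word S p.2))

theorem word_mem_wordSpan (S : Fin n → A) (μ ν : List (Fin n)) :
    word S μ * star (word S ν) ∈ wordSpan S :=
  Submodule.subset_span ⟨(μ, ν), rfl⟩

theorem IsCuntzFamily.wordSpan_mul_mem (hS : IsCuntzFamily S) (i : Fin n) {x : A}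
    (hx : x ∈ wordSpan S) : x * S i ∈ wordSpan S ∧ x * star (S i) ∈ wordSpan S := by
  induction hx using Submodule.span_induction with
  | mem x hx =>
    obtain ⟨⟨μ, ν⟩, rfl⟩ := hx
    constructor
    · obtain _ | ⟨j, ν⟩ := ν
      · simpa [word_append] using word_mem_wordSpan S (μ ++ [i]) []
      · by_cases hij : j = i
        · subst hij
          simpa [mul_assoc, hS.isometry] using word_mem_wordSpan S μ ν
        · simp [mul_assoc, hS.orthogonal hij]
    · simpa [mul_assoc] using word_mem_wordSpan S μ (i :: ν)
  | zero => simp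
  | add x y _ _ h1 h2 =>
    simp only [add_mul]
    exact ⟨add_mem h1.1 h2.1, add_mem h1.2 h2.2⟩
  | smul c x _ h =>
    simp only [smul_mul_assoc]
    exact ⟨Submodule.smul_mem _ c h.1, Submodule.smul_mem _ c h.2⟩

theorem IsCuntzFamily.adjoin_le_wordSpan (hS : IsCuntzFamily S) {x : A}
    (hx : x ∈ StarAlgebra.adjoin ℂ (Set.range S)) : x ∈ wordSpan S := by
  -- Only right multiplication by generators and their adjoints is easy to control, so the induction
  -- shows that right multiplication by `x` and by `star x` preserves the span; carrying both makes
  -- the star case trivial.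
  suffices h : (∀ y ∈ wordSpan S, y * x ∈ wordSpan S) ∧ ∀ y ∈ wordSpan S, y * star x ∈ wordSpan S by
    simpa using h.1 1 (by simpa using word_mem_wordSpan S [] [])
  induction hx using StarAlgebra.adjoin_induction with
  | mem x hx =>
    obtain ⟨i, rfl⟩ := hx
    exact ⟨fun y hy => (hS.wordSpan_mul_mem i hy).1, fun y hy => (hS.wordSpan_mul_mem i hy).2⟩
  | algebraMap r =>
    simp only [Algebra.algebraMap_eq_smul_one, star_smul, star_one, mul_smul_comm, mul_one]
    exact ⟨fun y hy => Submodule.smul_mem _ _ hy, fun y hy => Submodule.smul_mem _ _ hy⟩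
  | add x y _ _ h1 h2 =>
    simp only [star_add, mul_add]
    exact ⟨fun z hz => add_mem (h1.1 z hz) (h2.1 z hz), fun z hz => add_mem (h1.2 z hz) (h2.2 z hz)⟩
  | mul x y _ _ h1 h2 =>
    simp only [star_mul, ← mul_assoc]
    exact ⟨fun z hz => h2.1 _ (h1.1 z hz), fun z hz => h1.2 _ (h2.2 z hz)⟩
  | star x _ h =>
    rw [star_star]
    exact ⟨h.2, h.1⟩

theorem IsCuntzAlgebra.closure_wordSpan (hS : IsCuntzAlgebra S) :
    closure (wordSpan S : Set A) = Set.univ := by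
  refine Set.eq_univ_of_univ_subset ?_
  have h : ((StarAlgebra.adjoin ℂ (Set.range S)).topologicalClosure : Set A) = Set.univ := by
    rw [hS.generates]
    rfl
  rw [← h, StarSubalgebra.topologicalClosure_coe]
  exact closure_mono fun x hx => hS.isCuntzFamily.adjoin_le_wordSpan hx

end Words

/-! ### Words of equal length as matrix units. -/

section MatrixUnits

variable {A : Type*} [CStarAlgebra A] {n : ℕ} {S : Fin n → A}

/-- The words of length `k` as a system of matrix units. -/
def matrixMap (S : Fin n → A) (k : ℕ)
    (m : Matrix (List.Vector (Fin n) k) (List.Vector (Fin n) k) ℂ) : A :=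
  ∑ μ, ∑ ν, m μ ν • (word S μ.toList * star (word S ν.toList))

theorem IsCuntzFamily.matrixMap_mul_word (hS : IsCuntzFamily S) {k : ℕ}
    (m : Matrix (List.Vector (Fin n) k) (List.Vector (Fin n) k) ℂ) (κ : List.Vector (Fin n) k) :
    matrixMap S k m * word S κ.toList = ∑ μ, m μ κ • word S μ.toList := by
  simp only [matrixMap, Finset.sum_mul, smul_mul_assoc, mul_assoc, hS.star_vector_mul]
  simp

theorem IsCuntzFamily.matrixMap_mul (hS : IsCuntzFamily S) {k : ℕ}
    (m m' : Matrix (List.Vector (Fin n) k) (List.Vector (Fin n) k) ℂ) :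
    matrixMap S k (m * m') = matrixMap S k m * matrixMap S k m' := by
  conv_rhs => rw [matrixMap.eq_1 S k m']
  simp only [Finset.mul_sum, mul_smul_comm, ← mul_assoc, hS.matrixMap_mul_word]
  simp only [Finset.sum_mul, Finset.smul_sum, smul_mul_assoc, smul_smul]
  simp only [matrixMap, Matrix.mul_apply, Finset.sum_smul]
  rw [Finset.sum_comm]
  conv_rhs => rw [Finset.sum_comm]
  refine Finset.sum_congr rfl fun ν _ => ?_
  rw [Finset.sum_comm]
  refine Finset.sum_congr rfl fun μ _ => Finset.sum_congr rfl fun κ _ => ?_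
  rw [mul_comm]

open scoped Matrix in
/-- `matrixMap` as a *-homomorphism. -/
def IsCuntzFamily.matrixHom (hS : IsCuntzFamily S) (k : ℕ) :
    Matrix (List.Vector (Fin n) k) (List.Vector (Fin n) k) ℂ →⋆ₐ[ℂ] A where
  toFun := matrixMap S k
  map_one' := by
    rw [← hS.sum_rangeProj k]
    simp [matrixMap, Matrix.one_apply, rangeProj]
  map_zero' := by simp [matrixMap]
  map_add' x y := by simp [matrixMap, add_smul, Finset.sum_add_distrib]
  map_mul' := hS.matrixMap_mul
  commutes' c := by
    rw [Algebra.algebraMap_eq_smul_one, Algebra.algebraMap_eq_smul_one, ← hS.sum_rangeProj k]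
    simp [matrixMap, Matrix.one_apply, rangeProj, Finset.smul_sum]
  map_star' x := by
    simp only [matrixMap, star_sum, star_smul, star_mul, star_star, Matrix.star_apply]
    rw [Finset.sum_comm]

/-- Multiplying by `S_μ^*` on the left and `S_ν` on the right recovers the matrix entry at `(μ, ν)`.
-/
theorem IsCuntzFamily.matrixHom_injective [Nontrivial A] (hS : IsCuntzFamily S) (k : ℕ) :
    Function.Injective (hS.matrixHom k) := by
  rw [injective_iff_map_eq_zero]
  intro m hm
  ext μ ν
  have h : star (word S μ.toList) * (matrixMap S k m * word S ν.toList) = algebraMap ℂ A (m μ ν) := by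
    rw [hS.matrixMap_mul_word, Finset.mul_sum]
    simp [hS.star_vector_mul, Algebra.algebraMap_eq_smul_one]
  have h0 : matrixMap S k m = 0 := hm
  rw [h0, zero_mul, mul_zero] at h
  exact (FaithfulSMul.algebraMap_injective ℂ A) (by simpa using h.symm)

theorem IsCuntzFamily.exists_matrixMap (hS : IsCuntzFamily S) {k : ℕ} {x : A}
    (hx : x ∈ matrixLevel S k) : ∃ m, matrixMap S k m = x := by
  suffices h : matrixLevel S k ≤ LinearMap.range (hS.matrixHom k).toAlgHom.toLinearMap by
    exact h hx
  refine Submodule.span_le.2 ?_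
  rintro _ ⟨μ, ν, hμ, hν, rfl⟩
  obtain ⟨μ, rfl⟩ : ∃ μ' : List.Vector (Fin n) k, μ'.toList = μ := ⟨⟨μ, hμ⟩, rfl⟩
  obtain ⟨ν, rfl⟩ : ∃ ν' : List.Vector (Fin n) k, ν'.toList = ν := ⟨⟨ν, hν⟩, rfl⟩
  refine ⟨Matrix.single μ ν 1, ?_⟩
  change matrixMap S k _ = _
  rw [matrixMap, Fintype.sum_eq_single μ, Fintype.sum_eq_single ν]
  · simp
  · intro b hb
    simp [hb.symm]
  · intro b hb
    simp [hb.symm]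

theorem map_word {B F : Type*} [CStarAlgebra B] [FunLike F A B] [MonoidHomClass F A B] (π : F)
    (S : Fin n → A) (μ : List (Fin n)) : π (word S μ) = word (fun i => π (S i)) μ := by
  induction μ with
  | nil => simp
  | cons i μ ih => simp [ih]

theorem map_matrixMap {B : Type*} [CStarAlgebra B] (π : A →⋆ₐ[ℂ] B) (S : Fin n → A) (k : ℕ)
    (m : Matrix (List.Vector (Fin n) k) (List.Vector (Fin n) k) ℂ) :
    π (matrixMap S k m) = matrixMap (fun i => π (S i)) k m := by
  simp [matrixMap, map_star, map_word]

theorem IsCuntzFamily.map {B : Type*} [CStarAlgebra B] (hS : IsCuntzFamily S) (π : A →⋆ₐ[ℂ] B) :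
    IsCuntzFamily fun i => π (S i) where
  isometry i := by rw [← map_star, ← map_mul, hS.isometry, map_one]
  sum_range := by simp only [← map_star, ← map_mul, ← map_sum, hS.sum_range, map_one]

open scoped Matrix.Norms.L2Operator in
-- Both `x` and `π x` are images of the same matrix. The second image is isometric because the
-- matrix units in a nontrivial algebra are independent, and the first is contractive.
theorem IsCuntzFamily.norm_le_norm_map {B : Type*} [CStarAlgebra B] [Nontrivial B]
    (hS : IsCuntzFamily S) (π : A →⋆ₐ[ℂ] B) {k : ℕ} {x : A} (hx : x ∈ matrixLevel S k) :
    ‖x‖ ≤ ‖π x‖ := by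
  obtain ⟨m, rfl⟩ := hS.exists_matrixMap hx
  rw [map_matrixMap]
  have h1 : ‖matrixMap S k m‖ ≤ ‖m‖ := NonUnitalStarAlgHom.norm_apply_le (hS.matrixHom k) m
  have h2 : ‖matrixMap (fun i => π (S i)) k m‖ = ‖m‖ :=
    NonUnitalStarAlgHom.norm_map ((hS.map π).matrixHom k) ((hS.map π).matrixHom_injective k) m
  rw [h2]
  exact h1

/-- Inserting `1 = ∑ P_κ` between the two words lengthens both by `d`; this is how all levels are
compared. -/
theorem IsCuntzFamily.word_mul_star_word_eq_sum (hS : IsCuntzFamily S) (μ ν : List (Fin n))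
    (d : ℕ) : word S μ * star (word S ν) = ∑ κ : List.Vector (Fin n) d,
      word S (μ ++ κ.toList) * star (word S (ν ++ κ.toList)) := by
  calc word S μ * star (word S ν)
      = word S μ * (∑ κ : List.Vector (Fin n) d, rangeProj S κ.toList) * star (word S ν) := by
        rw [hS.sum_rangeProj, mul_one]
    _ = _ := by simp [Finset.mul_sum, Finset.sum_mul, word_append, rangeProj, mul_assoc]

theorem IsCuntzFamily.matrixLevel_mono (hS : IsCuntzFamily S) {j k : ℕ} (h : j ≤ k) :
    matrixLevel S j ≤ matrixLevel S k := by
  refine Submodule.span_le.2 ?_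
  rintro _ ⟨μ, ν, hμ, hν, rfl⟩
  rw [SetLike.mem_coe, hS.word_mul_star_word_eq_sum μ ν (k - j)]
  refine sum_mem fun κ _ => Submodule.subset_span ⟨_, _, ?_, ?_, rfl⟩
  · simp [hμ, h]
  · simp [hν, h]

end MatrixUnits

/-! ### Cuntz's compression onto degree zero. -/

section Compression

variable {A : Type*} [CStarAlgebra A] {n : ℕ} {S : Fin n → A}

/-- Moving `φᵈ` past the first `d` letters of `S_i^k S_j` confronts `(S_i^*)^d` with the final
`S_j`, which gives zero. The power `k` makes this work for every shift `1 ≤ d ≤ k`. -/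
theorem IsCuntzFamily.shift_iterate_star_mul_eq_zero (hS : IsCuntzFamily S) {i j : Fin n}
    (hij : i ≠ j) {k d : ℕ} (hd : d ≠ 0) (hdk : d ≤ k) :
    (shift S)^[d] (star (S i ^ k * S j)) * (S i ^ k * S j) = 0 := by
  have hpow (e : ℕ) : star (S i) ^ e * S i ^ e = 1 := by
    have h := hS.star_word_mul_self (List.replicate e i)
    simpa [word] using h
  have h1 (x : A) : (shift S)^[d] x * S i ^ d = S i ^ d * x := by
    have h := hS.shift_iterate_mul_word x (List.replicate d i)
    simpa [word] using h
  have h2 : star (S i) ^ d * S j = 0 := by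
    obtain ⟨e, rfl⟩ := Nat.exists_eq_succ_of_ne_zero hd
    rw [pow_succ, mul_assoc, hS.orthogonal hij, mul_zero]
  obtain ⟨e, rfl⟩ := Nat.exists_eq_add_of_le hdk
  have h3 : S i ^ (d + e) * S j = S i ^ d * (S i ^ e * S j) := by rw [pow_add, mul_assoc]
  have h4 : star (S i ^ (d + e) * S j) = star (S j) * (star (S i) ^ d * star (S i) ^ e) := by
    rw [star_mul, star_pow, pow_add]
  calc (shift S)^[d] (star (S i ^ (d + e) * S j)) * (S i ^ (d + e) * S j)
      = (shift S)^[d] (star (S i ^ (d + e) * S j)) * S i ^ d * (S i ^ e * S j) := by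
        conv_lhs => rw [h3, ← mul_assoc, ← h3]
    _ = S i ^ d * (star (S j) * (star (S i) ^ d * ((star (S i) ^ e * S i ^ e) * S j))) := by
        rw [h1, h4]
        simp only [mul_assoc]
    _ = 0 := by rw [hpow, one_mul, h2, mul_zero, mul_zero]

/-- Cuntz's compression: the isometry `φᵏ(Sᵢᵏ Sⱼ)` kills the words of nonzero degree of length at
most `k` and fixes those of degree zero. -/
theorem IsCuntzFamily.compress_word (hS : IsCuntzFamily S) {i j : Fin n}
    (hij : i ≠ j) {k : ℕ} {μ ν : List (Fin n)} (hμ : μ.length ≤ k) (hν : ν.length ≤ k) :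
    star ((shift S)^[k] (S i ^ k * S j)) * (word S μ * star (word S ν)) *
        (shift S)^[k] (S i ^ k * S j) =
      if μ.length = ν.length then word S μ * star (word S ν) else 0 := by
  set s := S i ^ k * S j with hs
  have hss : star s * s = 1 := by
    have h := hS.star_word_mul_self (List.replicate k i ++ [j])
    simpa [word_append, word, hs] using h
  have h1 : star ((shift S)^[k] s) * word S μ
      = word S μ * (shift S)^[k - μ.length] (star s) := by
    rw [← shift_iterate_star, ← hS.shift_iterate_mul_word, ← Function.iterate_add_apply,
      Nat.add_sub_cancel' hμ]
  have h2 : star (word S ν) * (shift S)^[k] s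
      = (shift S)^[k - ν.length] s * star (word S ν) := by
    rw [← hS.star_word_mul_shift_iterate, ← Function.iterate_add_apply,
      Nat.add_sub_cancel' hν]
  have h3 : star ((shift S)^[k] s) * (word S μ * star (word S ν)) * (shift S)^[k] s
      = word S μ * ((shift S)^[k - μ.length] (star s) * (shift S)^[k - ν.length] s) *
        star (word S ν) := by
    rw [← mul_assoc, h1, mul_assoc, h2]
    simp only [mul_assoc]
  rw [h3]
  -- For unequal lengths the middle factor is a shift of `φᵈ(s^*) s` or of `s^* φᵈ(s)`, with `d` the
  -- difference of the lengths, and vanishes; for equal lengths it is a shift of `s^* s = 1`.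
  rcases lt_trichotomy μ.length ν.length with h | h | h
  · rw [if_neg h.ne]
    have h4 : k - μ.length = (k - ν.length) + (ν.length - μ.length) := by omega
    rw [h4, Function.iterate_add_apply, ← hS.shift_iterate_mul,
      hS.shift_iterate_star_mul_eq_zero hij (by omega) (by omega), shift_iterate_zero]
    simp
  · rw [if_pos h, h, ← hS.shift_iterate_mul, hss, hS.shift_iterate_one, mul_one]
  · rw [if_neg h.ne']
    have h4 : k - ν.length = (k - μ.length) + (μ.length - ν.length) := by omega
    have h5 : star s * (shift S)^[μ.length - ν.length] s = 0 := by
      rw [← star_star (star s * _), star_mul, star_star, ← shift_iterate_star,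
        hS.shift_iterate_star_mul_eq_zero hij (by omega) (by omega), star_zero]
    rw [h4, Function.iterate_add_apply, ← hS.shift_iterate_mul, h5, shift_iterate_zero]
    simp

end Compression

/-! ### Averaging over the circle, and its faithfulness. -/

section CircleMean

open MeasureTheory AddCircle

variable {E : Type*} [CStarAlgebra E]

/-- The mean of a continuous function over the circle. -/
def circleMean (E : Type*) [CStarAlgebra E] : C(UnitAddCircle, E) →ₗ[ℂ] E where
  toFun f := ∫ t, f t ∂haarAddCircle
  map_add' f g := integral_add (f.continuous.integrable_of_hasCompactSupport
    (HasCompactSupport.of_compactSpace _)) (g.continuous.integrable_of_hasCompactSupport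
    (HasCompactSupport.of_compactSpace _))
  map_smul' c _ := integral_smul c _

theorem norm_circleMean_le (f : C(UnitAddCircle, E)) : ‖circleMean E f‖ ≤ ‖f‖ := by
  have h := norm_integral_le_of_norm_le_const (μ := (haarAddCircle : Measure UnitAddCircle))
    (f := f) (Filter.Eventually.of_forall f.norm_coe_le_norm)
  rwa [probReal_univ, mul_one] at h

theorem continuous_circleMean : Continuous (circleMean E) :=
  AddMonoidHomClass.continuous_of_bound (circleMean E) 1 fun f => by
    simpa using norm_circleMean_le f

theorem integral_fourier (d : ℤ) :
    ∫ t : UnitAddCircle, fourier d t ∂haarAddCircle = if d = 0 then 1 else 0 := by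
  split_ifs with h
  · simp [h]
  · exact integral_eq_zero_of_add_right_eq_neg (fourier_add_half_inv_index h one_pos)

/-- The function `t ↦ e^{2πidt} x` on the circle. -/
def fourierSMul (d : ℤ) (x : E) : C(UnitAddCircle, E) where
  toFun t := fourier d t • x
  continuous_toFun := (fourier d).continuous.smul continuous_const

theorem fourierSMul_apply (d : ℤ) (x : E) (t : UnitAddCircle) :
    fourierSMul d x t = fourier d t • x := rfl

theorem fourierSMul_apply_zero (d : ℤ) (x : E) : fourierSMul d x 0 = x := by
  rw [fourierSMul_apply, fourier_eval_zero, one_smul]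

theorem circleMean_fourierSMul (d : ℤ) (x : E) :
    circleMean E (fourierSMul d x) = if d = 0 then x else 0 := by
  change ∫ t : UnitAddCircle, fourier d t • x ∂haarAddCircle = _
  rw [integral_smul_const, integral_fourier]
  split_ifs <;> simp

/-- A nonnegative function with integral zero has integral zero over every set, hence vanishes
almost everywhere; by continuity it vanishes everywhere. This yields injectivity in the proof of
universality. -/
theorem eq_zero_of_circleMean_star_mul_self_eq_zero {f : C(UnitAddCircle, E)}
    (hf : circleMean E (star f * f) = 0) : f = 0 := by
  let _ : PartialOrder E := CStarAlgebra.spectralOrder E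
  have : StarOrderedRing E := CStarAlgebra.spectralOrderedRing E
  have hint : Integrable (star f * f : C(UnitAddCircle, E)) haarAddCircle :=
    (star f * f).continuous.integrable_of_hasCompactSupport (HasCompactSupport.of_compactSpace _)
  have hpos (t) : 0 ≤ (star f * f) t := star_mul_self_nonneg (f t)
  have hset (s : Set UnitAddCircle) : ∫ t in s, (star f * f) t ∂haarAddCircle = 0 := by
    refine le_antisymm ?_ (integral_nonneg hpos)
    refine (setIntegral_mono_set (t := Set.univ) hint.integrableOn
      (Filter.Eventually.of_forall hpos) (Filter.Eventually.of_forall fun _ _ => trivial)).trans ?_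
    rw [setIntegral_univ]
    exact hf.le
  have hae := ae_eq_zero_of_forall_setIntegral_eq_of_sigmaFinite
    (fun s _ _ => hint.integrableOn) (fun s _ _ => hset s)
  have h0 := (Continuous.ae_eq_iff_eq _ (star f * f).continuous continuous_zero).1 hae
  have h1 : star f * f = 0 := DFunLike.coe_injective h0
  exact CStarRing.star_mul_self_eq_zero_iff f |>.1 h1

end CircleMean

/-! ### Universality of the Cuntz algebra. -/

section Universality

variable {E A B : Type*} [CStarAlgebra E] [CStarAlgebra A] [CStarAlgebra B] {n : ℕ}

/-- The family `t ↦ e^{2πit} S i` of continuous functions on the circle. -/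
def gaugeFamily (S : Fin n → E) (i : Fin n) : C(UnitAddCircle, E) :=
  fourierSMul 1 (S i)

theorem gaugeFamily_apply (S : Fin n → E) (i : Fin n) (t : UnitAddCircle) :
    gaugeFamily S i t = fourier 1 t • S i := rfl

theorem word_gaugeFamily_apply (S : Fin n → E) (μ : List (Fin n)) (t : UnitAddCircle) :
    word (gaugeFamily S) μ t = fourier μ.length t • word S μ := by
  induction μ with
  | nil => simp
  | cons i μ ih =>
    rw [word_cons, ContinuousMap.mul_apply, ih, gaugeFamily_apply, word_cons, smul_mul_smul_comm,
      ← fourier_add, List.length_cons, Nat.cast_succ, add_comm (1 : ℤ)]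

theorem word_gaugeFamily_mul_star (S : Fin n → E) (μ ν : List (Fin n)) :
    word (gaugeFamily S) μ * star (word (gaugeFamily S) ν) =
      fourierSMul (μ.length - ν.length : ℤ) (word S μ * star (word S ν)) := by
  ext t
  rw [ContinuousMap.mul_apply, ContinuousMap.star_apply, word_gaugeFamily_apply,
    word_gaugeFamily_apply, star_smul, smul_mul_smul_comm, sub_eq_add_neg]
  rw [fourierSMul_apply, fourier_add, fourier_neg]
  rfl

theorem IsCuntzFamily.isCuntzFamily_gaugeFamily {S : Fin n → E} (hS : IsCuntzFamily S) :
    IsCuntzFamily (gaugeFamily S) where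
  isometry i := by
    ext t
    have h : star (fourier 1 t : ℂ) * fourier 1 t = 1 := by
      rw [← starRingEnd_apply, ← fourier_neg, ← fourier_add]
      simp
    rw [ContinuousMap.mul_apply, ContinuousMap.star_apply, gaugeFamily_apply, star_smul,
      smul_mul_smul_comm, hS.isometry, h, one_smul]
    rfl
  sum_range := by
    have h (i : Fin n) : gaugeFamily S i * star (gaugeFamily S i)
        = fourierSMul 0 (S i * star (S i)) := by
      simpa using word_gaugeFamily_mul_star S [i] [i]
    ext t
    simp only [h, ContinuousMap.coe_sum, Finset.sum_apply, fourierSMul_apply, fourier_zero,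
      one_smul, hS.sum_range, ContinuousMap.one_apply]

/-- The frequency of a word in the gauge family is its degree `|μ| - |ν|`, so integration and
compression keep exactly the same words. The mean of `f` can therefore be read off, under `π`, from
the single value `f 0`. -/
theorem exists_compression {S : Fin n → E} (hS : IsCuntzFamily S) (π : E →⋆ₐ[ℂ] A) {i j : Fin n}
    (hij : i ≠ j) {f : C(UnitAddCircle, E)} (hf : f ∈ wordSpan (gaugeFamily S)) :
    ∃ K, ∀ k ≥ K, circleMean E f ∈ matrixLevel S k ∧
      star ((shift fun i => π (S i))^[k] (π (S i) ^ k * π (S j))) * π (f 0) *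
        ((shift fun i => π (S i))^[k] (π (S i) ^ k * π (S j))) = π (circleMean E f) := by
  induction hf using Submodule.span_induction with
  | mem x hx =>
    obtain ⟨⟨μ, ν⟩, rfl⟩ := hx
    refine ⟨max μ.length ν.length, fun k hk => ?_⟩
    have hμ : μ.length ≤ k := (le_max_left _ _).trans hk
    have hν : ν.length ≤ k := (le_max_right _ _).trans hk
    simp only [word_gaugeFamily_mul_star, circleMean_fourierSMul, sub_eq_zero, Nat.cast_inj]
    constructor
    · split_ifs with h
      · exact hS.matrixLevel_mono hμ (Submodule.subset_span ⟨μ, ν, rfl, h.symm, rfl⟩)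
      · exact zero_mem _
    · rw [fourierSMul_apply_zero, apply_ite π, map_mul, map_star, map_word, map_word, map_zero]
      exact (hS.map π).compress_word hij hμ hν
  | zero => exact ⟨0, fun k _ => by simp⟩
  | add x y _ _ hx hy =>
    obtain ⟨K, hK⟩ := hx
    obtain ⟨L, hL⟩ := hy
    refine ⟨max K L, fun k hk => ?_⟩
    obtain ⟨h1, h2⟩ := hK k ((le_max_left _ _).trans hk)
    obtain ⟨h3, h4⟩ := hL k ((le_max_right _ _).trans hk)
    rw [map_add, map_add, ContinuousMap.add_apply, map_add, mul_add, add_mul, h2, h4]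
    exact ⟨add_mem h1 h3, rfl⟩
  | smul c x _ hx =>
    obtain ⟨K, hK⟩ := hx
    refine ⟨K, fun k hk => ?_⟩
    obtain ⟨h1, h2⟩ := hK k hk
    rw [map_smul, map_smul, ContinuousMap.smul_apply, map_smul, mul_smul_comm, smul_mul_assoc, h2]
    exact ⟨Submodule.smul_mem _ c h1, rfl⟩

theorem norm_le_one_of_star_mul_self {w : A} (hw : star w * w = 1) : ‖w‖ ≤ 1 := by
  have h := CStarRing.norm_star_mul_self (x := w)
  rw [hw] at h
  nontriviality A
  rw [norm_one] at h
  nlinarith [norm_nonneg w]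

theorem continuous_starAlgHom (π : A →⋆ₐ[ℂ] B) : Continuous π :=
  AddMonoidHomClass.continuous_of_bound π 1 fun x => by
    simpa using NonUnitalStarAlgHom.norm_apply_le π x

/-- The compressing element is an isometry, and `π` preserves norms on matrix levels, so the
estimate holds on the dense span; it is a closed condition. -/
theorem norm_circleMean_le_norm_map [Nontrivial A] (hn : 2 ≤ n) {S : Fin n → E}
    (hS : IsCuntzFamily S) (π : E →⋆ₐ[ℂ] A) {f : C(UnitAddCircle, E)}
    (hf : f ∈ (StarAlgebra.adjoin ℂ (Set.range (gaugeFamily S))).topologicalClosure) :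
    ‖circleMean E f‖ ≤ ‖π (f 0)‖ := by
  have hcont : Continuous π := continuous_starAlgHom π
  have hclosed : IsClosed {f : C(UnitAddCircle, E) | ‖circleMean E f‖ ≤ ‖π (f 0)‖} :=
    isClosed_le continuous_circleMean.norm
      (hcont.comp (continuous_eval_const 0)).norm
  refine closure_minimal ?_ hclosed hf
  intro f hf
  have hij : (⟨0, by omega⟩ : Fin n) ≠ ⟨1, by omega⟩ := by simp
  obtain ⟨k, hk⟩ := exists_compression hS π hij (hS.isCuntzFamily_gaugeFamily.adjoin_le_wordSpan hf)
  obtain ⟨h1, h2⟩ := hk k le_rfl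
  refine (hS.norm_le_norm_map π h1).trans ?_
  have hw : ‖(shift fun i => π (S i))^[k] (π (S ⟨0, by omega⟩) ^ k * π (S ⟨1, by omega⟩))‖ ≤ 1 := by
    refine norm_le_one_of_star_mul_self ?_
    simpa using (hS.map π).compress_word hij (Nat.zero_le k) (Nat.zero_le k) (μ := []) (ν := [])
  rw [← h2]
  refine (norm_mul_le _ _).trans <| (mul_le_of_le_one_right (norm_nonneg _) hw).trans <|
    (norm_mul_le _ _).trans <| mul_le_of_le_one_left (norm_nonneg _) ?_
  rwa [norm_star]

/-- Evaluation at a point of the circle as a *-homomorphism. -/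
def evalStarHom (E : Type*) [CStarAlgebra E] (t : UnitAddCircle) :
    C(UnitAddCircle, E) →⋆ₐ[ℂ] E where
  toFun f := f t
  map_one' := rfl
  map_zero' := rfl
  map_add' _ _ := rfl
  map_mul' _ _ := rfl
  commutes' _ := rfl
  map_star' _ := rfl

/-- Universality of the Cuntz algebra together with its gauge action: for every family `T` of
isometries as in `IsCuntzFamily` the assignment `S i ↦ (t ↦ e^{2πit} T i)` extends to a
*-homomorphism. -/
theorem IsCuntzAlgebra.exists_gaugeHom [Nontrivial A] (hn : 2 ≤ n) {S : Fin n → A}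
    (hS : IsCuntzAlgebra S) {T : Fin n → B} (hT : IsCuntzFamily T) :
    ∃ Ψ : A →⋆ₐ[ℂ] C(UnitAddCircle, B), ∀ i, Ψ (S i) = gaugeFamily T i := by
  -- Pairing the two families makes the graph of the desired homomorphism an algebra generated by a
  -- Cuntz family. The norm estimate involves only the first coordinate, so the algebra `C` of loops
  -- projects isomorphically onto `A`; the second coordinate then gives the homomorphism.
  let U : Fin n → A × B := fun i => (S i, T i)
  have hU : IsCuntzFamily U :=
    ⟨fun i => Prod.ext (hS.isometry i) (hT.isometry i), Prod.ext
      (by simpa [U, Prod.fst_sum] using hS.sum_range) (by simpa [U, Prod.snd_sum] using hT.sum_range)⟩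
  let C := (StarAlgebra.adjoin ℂ (Set.range (gaugeFamily U))).topologicalClosure
  have : IsClosed (C : Set C(UnitAddCircle, A × B)) := StarSubalgebra.isClosed_topologicalClosure _
  let π : C →⋆ₐ[ℂ] A := (StarAlgHom.fst ℂ A B).comp
    ((evalStarHom (A × B) (0 : UnitAddCircle)).comp C.subtype)
  have hπ (f : C) : ‖circleMean (A × B) f‖ ≤ ‖π f‖ :=
    norm_circleMean_le_norm_map hn hU (StarAlgHom.fst ℂ A B) f.2
  -- The estimate bounds only the mean, so it is applied to `star f * f`, where the mean is
  -- faithful.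
  have hinj : Function.Injective π := by
    rw [injective_iff_map_eq_zero]
    intro f hf
    have h1 : π (star f * f) = 0 := by rw [map_mul, hf, mul_zero]
    have h2 := hπ (star f * f)
    rw [h1, norm_zero, norm_le_zero_iff] at h2
    exact Subtype.ext (eq_zero_of_circleMean_star_mul_self_eq_zero h2)
  have hiso : Isometry π := NonUnitalStarAlgHom.isometry π hinj
  have hmem (i : Fin n) : gaugeFamily U i ∈ C :=
    StarSubalgebra.le_topologicalClosure _ (StarAlgebra.subset_adjoin ℂ _ ⟨i, rfl⟩)
  have hπS (i : Fin n) : π ⟨_, hmem i⟩ = S i := by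
    change (gaugeFamily U i 0).1 = S i
    rw [gaugeFamily, fourierSMul_apply_zero]
  have hsurj : Function.Surjective π := by
    have h : (StarAlgebra.adjoin ℂ (Set.range S)).topologicalClosure ≤ π.range := by
      refine StarSubalgebra.topologicalClosure_minimal (StarAlgebra.adjoin_le ?_) ?_
      · rintro _ ⟨i, rfl⟩
        exact ⟨_, hπS i⟩
      · exact hiso.isClosedEmbedding.isClosed_range
    rw [hS.generates] at h
    intro x
    exact h (StarSubalgebra.mem_top (x := x))
  let e : C ≃⋆ₐ[ℂ] A := StarAlgEquiv.ofBijective π ⟨hinj, hsurj⟩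
  have hcont : Continuous (StarAlgHom.snd ℂ A B) := continuous_snd
  refine ⟨(ContinuousMap.compStarAlgHom UnitAddCircle (StarAlgHom.snd ℂ A B) hcont).comp
    (C.subtype.comp (e.symm : A →⋆ₐ[ℂ] C)), fun i => ?_⟩
  have he : e.symm (S i) = ⟨_, hmem i⟩ := e.symm_apply_eq.2 (hπS i).symm
  change ContinuousMap.compStarAlgHom UnitAddCircle (StarAlgHom.snd ℂ A B) hcont
    (e.symm (S i) : C(UnitAddCircle, A × B)) = _
  rw [he]
  rfl

end Universality

/-! ### The gauge action and the core as its fixed point algebra. -/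

section Gauge

open MeasureTheory AddCircle

variable {A : Type*} [CStarAlgebra A] {n : ℕ} {S : Fin n → A}

theorem IsCuntzAlgebra.hom_ext {B : Type*} [CStarAlgebra B] (hS : IsCuntzAlgebra S)
    {f g : A →⋆ₐ[ℂ] B} (h : ∀ i, f (S i) = g (S i)) : f = g := by
  have hle : (StarAlgebra.adjoin ℂ (Set.range S)).topologicalClosure ≤ StarAlgHom.equalizer f g := by
    refine StarSubalgebra.topologicalClosure_minimal (StarAlgebra.adjoin_le ?_) ?_
    · rintro _ ⟨i, rfl⟩
      exact h i
    · exact isClosed_eq (continuous_starAlgHom f) (continuous_starAlgHom g)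
  rw [hS.generates] at hle
  ext x
  exact hle (StarSubalgebra.mem_top (x := x))

theorem IsCuntzAlgebra.exists_endomorphism [Nontrivial A] (hn : 2 ≤ n) (hS : IsCuntzAlgebra S) {u : A} (hu : u ∈ unitary A) :
    ∃ f : A →⋆ₐ[ℂ] A, ∀ i, f (S i) = u * S i := by
  obtain ⟨Ψ, hΨ⟩ := hS.exists_gaugeHom hn (hS.isCuntzFamily.unitary_mul hu)
  refine ⟨(evalStarHom A 0).comp Ψ, fun i => ?_⟩
  change Ψ (S i) 0 = _
  rw [hΨ, gaugeFamily, fourierSMul_apply_zero]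

variable [Nontrivial A] (hn : 2 ≤ n) (hS : IsCuntzAlgebra S)

/-- The gauge action, as a *-homomorphism into the continuous functions on the circle. -/
def gaugeHom : A →⋆ₐ[ℂ] C(UnitAddCircle, A) :=
  (hS.exists_gaugeHom hn hS.isCuntzFamily).choose

theorem gaugeHom_generator (i : Fin n) : gaugeHom hn hS (S i) = gaugeFamily S i :=
  (hS.exists_gaugeHom hn hS.isCuntzFamily).choose_spec i

theorem gaugeHom_word (μ ν : List (Fin n)) : gaugeHom hn hS (word S μ * star (word S ν)) =
    fourierSMul (μ.length - ν.length : ℤ) (word S μ * star (word S ν)) := by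
  rw [map_mul, map_star, map_word, map_word, ← word_gaugeFamily_mul_star]
  simp only [gaugeHom_generator]

/-- The mean over the gauge action. -/
def gaugeMean (x : A) : A := circleMean A (gaugeHom hn hS x)

theorem gaugeMean_sum {ι : Type*} (s : Finset ι) (f : ι → A) :
    gaugeMean hn hS (∑ j ∈ s, f j) = ∑ j ∈ s, gaugeMean hn hS (f j) := by
  simp [gaugeMean]

theorem gaugeMean_word (μ ν : List (Fin n)) : gaugeMean hn hS (word S μ * star (word S ν)) =
    if μ.length = ν.length then word S μ * star (word S ν) else 0 := by
  rw [gaugeMean, gaugeHom_word, circleMean_fourierSMul]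
  simp [sub_eq_zero]

/-- Invariance under the gauge action. -/
def IsGaugeInvariant (x : A) : Prop := ∀ t, gaugeHom hn hS x t = x

variable {hn hS}

theorem IsGaugeInvariant.gaugeMean_eq {x : A} (hx : IsGaugeInvariant hn hS x) :
    gaugeMean hn hS x = x := by
  change ∫ t, gaugeHom hn hS x t ∂haarAddCircle = x
  simp only [hx _]
  simp

/-- On the dense span of words the mean is an element of a matrix level, by the compression lemma
with `π` the identity; continuity does the rest. -/
theorem gaugeMean_mem_core (x : A) : gaugeMean hn hS x ∈ core S := by
  have hcont : Continuous (gaugeMean hn hS) :=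
    continuous_circleMean.comp (continuous_starAlgHom (gaugeHom hn hS))
  have hx : x ∈ closure (wordSpan S : Set A) := by rw [hS.closure_wordSpan]; trivial
  refine closure_minimal ?_ (isClosed_closure.preimage hcont) hx
  intro y hy
  have hy' : gaugeHom hn hS y ∈ wordSpan (gaugeFamily S) := by
    have hle : wordSpan S ≤ (wordSpan (gaugeFamily S)).comap
        (gaugeHom hn hS).toAlgHom.toLinearMap := by
      refine Submodule.span_le.2 ?_
      rintro _ ⟨⟨μ, ν⟩, rfl⟩
      change gaugeHom hn hS (word S μ * star (word S ν)) ∈ wordSpan (gaugeFamily S)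
      rw [gaugeHom_word, ← word_gaugeFamily_mul_star]
      exact word_mem_wordSpan _ μ ν
    exact hle hy
  have hij : (⟨0, by omega⟩ : Fin n) ≠ ⟨1, by omega⟩ := by simp
  obtain ⟨k, hk⟩ := exists_compression hS.isCuntzFamily (StarAlgHom.id ℂ A) hij hy'
  exact subset_closure (Set.mem_iUnion.2 ⟨k, (hk k le_rfl).1⟩)

theorem isGaugeInvariant_iff_mem_core {x : A} : IsGaugeInvariant hn hS x ↔ x ∈ core S := by
  refine ⟨fun hx => hx.gaugeMean_eq ▸ gaugeMean_mem_core x, fun hx t => ?_⟩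
  have hcont : Continuous fun x => gaugeHom hn hS x t :=
    (continuous_eval_const t).comp (continuous_starAlgHom (gaugeHom hn hS))
  refine closure_minimal ?_ (isClosed_eq hcont continuous_id) hx
  refine Set.iUnion_subset fun k => ?_
  have hle : matrixLevel S k ≤ LinearMap.eqLocus
      (((evalStarHom A t).comp (gaugeHom hn hS)).toAlgHom.toLinearMap) LinearMap.id := by
    refine Submodule.span_le.2 ?_
    rintro _ ⟨μ, ν, hμ, hν, rfl⟩
    change gaugeHom hn hS (word S μ * star (word S ν)) t = word S μ * star (word S ν)
    rw [gaugeHom_word, hμ, hν, sub_self, fourierSMul_apply, fourier_zero, one_smul]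
  exact hle

/-- An endomorphism `λ_u` with gauge-invariant `u` commutes with the gauge action, as both
composites agree on the generators. -/
theorem gaugeHom_map {f : A →⋆ₐ[ℂ] A} {u : A} (hu : u ∈ core S)
    (hf : ∀ i, f (S i) = u * S i) (x : A) (t : UnitAddCircle) :
    gaugeHom hn hS (f x) t = f (gaugeHom hn hS x t) := by
  have h : ((evalStarHom A t).comp (gaugeHom hn hS)).comp f
      = f.comp ((evalStarHom A t).comp (gaugeHom hn hS)) := by
    refine hS.hom_ext fun i => ?_
    change gaugeHom hn hS (f (S i)) t = f (gaugeHom hn hS (S i) t)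
    rw [hf, map_mul, gaugeHom_generator, ContinuousMap.mul_apply,
      isGaugeInvariant_iff_mem_core.2 hu t, gaugeFamily_apply, map_smul, hf, mul_smul_comm]
  exact DFunLike.congr_fun h x

theorem mem_core_of_map_mem_core (hn : 2 ≤ n) (hS : IsCuntzAlgebra S) {ρ : A ≃⋆ₐ[ℂ] A} {u : A}
    (hu : u ∈ core S) (hρ : ∀ i, ρ (S i) = u * S i) {x : A} (hx : ρ x ∈ core S) : x ∈ core S := by
  refine (isGaugeInvariant_iff_mem_core (hn := hn) (hS := hS)).1 fun t => EquivLike.injective ρ ?_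
  have h := gaugeHom_map (hn := hn) (hS := hS) (f := (ρ : A →⋆ₐ[ℂ] A)) hu hρ x t
  change gaugeHom hn hS (ρ x) t = ρ (gaugeHom hn hS x t) at h
  rw [← h, isGaugeInvariant_iff_mem_core.2 hx t]

end Gauge

/-! ### Permutative unitaries as permutations of words. -/

section PermutationMatrices

/-- A unitary matrix of natural numbers is a permutation matrix. -/
theorem exists_perm_of_sum_mul_eq {V : Type*} [Fintype V] [DecidableEq V] {N : V → V → ℕ}
    (hN : ∀ μ ν, ∑ κ, N κ μ * N κ ν = if μ = ν then 1 else 0) :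
    ∃ σ : Equiv.Perm V, ∀ κ μ, N κ μ = if κ = σ μ then 1 else 0 := by
  have hex (μ : V) : ∃ κ, N κ μ ≠ 0 := by
    by_contra! h
    have := hN μ μ
    simp [h] at this
  choose s hs using hex
  have hle (κ μ ν : V) : N κ μ * N κ ν ≤ if μ = ν then 1 else 0 := by
    rw [← hN μ ν]
    exact Finset.single_le_sum (f := fun κ => N κ μ * N κ ν) (fun _ _ => Nat.zero_le _)
      (Finset.mem_univ κ)
  -- Orthogonal columns with nonnegative entries have disjoint supports, so a choice of a nonzero
  -- row in each column is injective.
  have hinj : Function.Injective s := by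
    intro μ ν h
    by_contra hne
    have h1 := hle (s μ) μ ν
    rw [if_neg hne, Nat.le_zero, mul_eq_zero] at h1
    exact h1.elim (hs μ) (h ▸ hs ν)
  refine ⟨Equiv.ofBijective s (Finite.injective_iff_bijective.1 hinj), fun κ μ => ?_⟩
  have h1 : N (s μ) μ = 1 := by
    have h2 := hle (s μ) μ μ
    rw [if_pos rfl] at h2
    have h3 := Nat.pos_of_ne_zero (hs μ)
    nlinarith
  rw [Equiv.ofBijective_apply]
  split_ifs with h
  · rw [h, h1]
  · have h2 := hN μ μ
    rw [if_pos rfl, ← Finset.add_sum_erase _ _ (Finset.mem_univ (s μ)), h1, mul_one,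
      Nat.add_eq_left, Finset.sum_eq_zero_iff] at h2
    simpa using h2 κ (Finset.mem_erase.2 ⟨h, Finset.mem_univ _⟩)

variable {A : Type*} [CStarAlgebra A] {n : ℕ} {S : Fin n → A}

/-- Sums of words `S_μ S_ν^*` with `μ` and `ν` of length `k`. -/
def permLevel (S : Fin n → A) (k : ℕ) : AddSubmonoid A :=
  AddSubmonoid.closure {x | ∃ μ ν : List (Fin n), μ.length = k ∧ ν.length = k ∧
    x = word S μ * star (word S ν)}

theorem word_mem_permLevel (S : Fin n → A) {k : ℕ} {μ ν : List (Fin n)} (hμ : μ.length = k)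
    (hν : ν.length = k) : word S μ * star (word S ν) ∈ permLevel S k :=
  AddSubmonoid.subset_closure ⟨μ, ν, hμ, hν, rfl⟩

theorem IsCuntzFamily.permLevel_mono (hS : IsCuntzFamily S) {j k : ℕ} (h : j ≤ k) :
    permLevel S j ≤ permLevel S k := by
  refine AddSubmonoid.closure_le.2 ?_
  rintro _ ⟨μ, ν, hμ, hν, rfl⟩
  rw [SetLike.mem_coe, hS.word_mul_star_word_eq_sum μ ν (k - j)]
  exact sum_mem fun κ _ => word_mem_permLevel S (by simp [hμ, h]) (by simp [hν, h])

theorem permLevel_le_matrixLevel (S : Fin n → A) (k : ℕ) :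
    permLevel S k ≤ (matrixLevel S k).toAddSubmonoid :=
  AddSubmonoid.closure_le.2 Submodule.subset_span

theorem IsCuntzFamily.mul_mem_permLevel (hS : IsCuntzFamily S) {k : ℕ} {x y : A}
    (hx : x ∈ permLevel S k) (hy : y ∈ permLevel S k) : x * y ∈ permLevel S k := by
  induction hx, hy using AddSubmonoid.closure_induction₂ with
  | mem x y hx hy =>
    obtain ⟨μ, ν, hμ, hν, rfl⟩ := hx
    obtain ⟨κ, τ, hκ, hτ, rfl⟩ := hy
    rw [mul_assoc, ← mul_assoc (star _), hS.star_word_mul_word (hν.trans hκ.symm)]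
    split_ifs
    · rw [one_mul]
      exact word_mem_permLevel S hμ hτ
    · simp
  | zero_left => simp
  | zero_right => simp
  | add_left x y z _ _ _ h1 h2 => rw [add_mul]; exact add_mem h1 h2
  | add_right x y z _ _ _ h1 h2 => rw [mul_add]; exact add_mem h1 h2

theorem star_mem_permLevel {k : ℕ} {x : A} (hx : x ∈ permLevel S k) : star x ∈ permLevel S k := by
  induction hx using AddSubmonoid.closure_induction with
  | mem x hx =>
    obtain ⟨μ, ν, hμ, hν, rfl⟩ := hx
    rw [star_mul, star_star]
    exact word_mem_permLevel S hν hμ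
  | zero => simp
  | add x y _ _ h1 h2 => rw [star_add]; exact add_mem h1 h2

theorem generator_mul_mem_permLevel {k : ℕ} {x : A} (hx : x ∈ permLevel S k) (i j : Fin n) :
    S i * x * star (S j) ∈ permLevel S (k + 1) := by
  induction hx using AddSubmonoid.closure_induction with
  | mem x hx =>
    obtain ⟨μ, ν, hμ, hν, rfl⟩ := hx
    have h : S i * (word S μ * star (word S ν)) * star (S j)
        = word S (i :: μ) * star (word S (j :: ν)) := by simp [mul_assoc]
    rw [h]
    exact word_mem_permLevel S (by simp [hμ]) (by simp [hν])
  | zero => simp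
  | add x y _ _ h1 h2 => rw [mul_add, add_mul]; exact add_mem h1 h2

/-- A word `S_μ S_ν^*` with `|μ| = |ν| = k` carries `φᵏ(x)` through to `x` and back. This is the
source of the exponent `m` in the definition of `𝔊`. -/
theorem IsCuntzFamily.matrixLevel_commute_shift (hS : IsCuntzFamily S) {k : ℕ} {y : A}
    (hy : y ∈ matrixLevel S k) (x : A) : y * (shift S)^[k] x = (shift S)^[k] x * y := by
  induction hy using Submodule.span_induction with
  | mem y hy =>
    obtain ⟨μ, ν, hμ, hν, rfl⟩ := hy
    have h1 := hS.star_word_mul_shift_iterate x ν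
    have h2 := hS.shift_iterate_mul_word x μ
    rw [hν] at h1
    rw [hμ] at h2
    rw [mul_assoc, h1, ← mul_assoc, ← mul_assoc, h2]
  | zero => simp
  | add y z _ _ h1 h2 => rw [add_mul, mul_add, h1, h2]
  | smul c y _ h => rw [smul_mul_assoc, mul_smul_comm, h]

/-- The unitaries that lie in some `permLevel S k`. -/
def IsPermUnitary (S : Fin n → A) (u : A) : Prop := u ∈ unitary A ∧ ∃ k, u ∈ permLevel S k

theorem IsPermUnitary.one (S : Fin n → A) : IsPermUnitary S 1 :=
  ⟨one_mem _, 0, by simpa using word_mem_permLevel S (μ := []) (ν := []) rfl rfl⟩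

theorem IsPermUnitary.star_mem {u : A} (hu : IsPermUnitary S u) : IsPermUnitary S (star u) :=
  ⟨Unitary.star_mem hu.1, hu.2.imp fun _ => star_mem_permLevel⟩

theorem IsCuntzFamily.exists_permLevel_mul (hS : IsCuntzFamily S) {x y : A}
    (hx : ∃ k, x ∈ permLevel S k) (hy : ∃ k, y ∈ permLevel S k) : ∃ k, x * y ∈ permLevel S k := by
  obtain ⟨j, hj⟩ := hx
  obtain ⟨k, hk⟩ := hy
  exact ⟨max j k, hS.mul_mem_permLevel (hS.permLevel_mono (le_max_left j k) hj)
    (hS.permLevel_mono (le_max_right j k) hk)⟩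

theorem IsCuntzFamily.exists_permLevel_add (hS : IsCuntzFamily S) {x y : A}
    (hx : ∃ k, x ∈ permLevel S k) (hy : ∃ k, y ∈ permLevel S k) : ∃ k, x + y ∈ permLevel S k := by
  obtain ⟨j, hj⟩ := hx
  obtain ⟨k, hk⟩ := hy
  exact ⟨max j k, add_mem (hS.permLevel_mono (le_max_left j k) hj)
    (hS.permLevel_mono (le_max_right j k) hk)⟩

theorem IsCuntzFamily.exists_permLevel_sum (hS : IsCuntzFamily S) {ι : Type*} {s : Finset ι}
    {f : ι → A} (hf : ∀ j ∈ s, ∃ k, f j ∈ permLevel S k) : ∃ k, ∑ j ∈ s, f j ∈ permLevel S k :=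
  Finset.sum_induction f (fun x => ∃ k, x ∈ permLevel S k)
    (fun _ _ => hS.exists_permLevel_add) ⟨0, zero_mem _⟩ hf

theorem IsPermUnitary.mul (hS : IsCuntzFamily S) {u v : A} (hu : IsPermUnitary S u)
    (hv : IsPermUnitary S v) : IsPermUnitary S (u * v) :=
  ⟨mul_mem hu.1 hv.1, hS.exists_permLevel_mul hu.2 hv.2⟩

/-- The unitary that permutes the words of length `k`. -/
def permElement (S : Fin n → A) {k : ℕ} (σ : Equiv.Perm (List.Vector (Fin n) k)) : A :=
  ∑ μ, word S (σ μ).toList * star (word S μ.toList)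

theorem IsCuntzFamily.permElement_mul_word (hS : IsCuntzFamily S) {k : ℕ}
    (σ : Equiv.Perm (List.Vector (Fin n) k)) (μ : List.Vector (Fin n) k) :
    permElement S σ * word S μ.toList = word S (σ μ).toList := by
  simp [permElement, Finset.sum_mul, mul_assoc, hS.star_vector_mul]

theorem IsCuntzFamily.permElement_conj_rangeProj (hS : IsCuntzFamily S) {k : ℕ}
    (σ : Equiv.Perm (List.Vector (Fin n) k)) (μ : List.Vector (Fin n) k) (τ : List (Fin n)) :
    permElement S σ * rangeProj S (μ.toList ++ τ) * star (permElement S σ)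
      = rangeProj S ((σ μ).toList ++ τ) := by
  have h : permElement S σ * word S (μ.toList ++ τ) = word S ((σ μ).toList ++ τ) := by
    rw [word_append, ← mul_assoc, hS.permElement_mul_word, word_append]
  rw [rangeProj, ← mul_assoc, h, mul_assoc, ← star_mul, h, rangeProj]

theorem permElement_mem_permLevel (S : Fin n → A) {k : ℕ}
    (σ : Equiv.Perm (List.Vector (Fin n) k)) : permElement S σ ∈ permLevel S k :=
  sum_mem fun _ _ => word_mem_permLevel S (List.Vector.toList_length _) (List.Vector.toList_length _)

theorem IsCuntzFamily.permElement_mul_star (hS : IsCuntzFamily S) {k : ℕ}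
    (σ : Equiv.Perm (List.Vector (Fin n) k)) : permElement S σ * star (permElement S σ) = 1 := by
  calc permElement S σ * star (permElement S σ)
      = ∑ μ : List.Vector (Fin n) k, permElement S σ * rangeProj S (μ.toList ++ []) * star (permElement S σ) := by
        simp only [List.append_nil]
        rw [← Finset.sum_mul, ← Finset.mul_sum, hS.sum_rangeProj, mul_one]
    _ = ∑ μ, rangeProj S (σ μ).toList := by
        simp only [hS.permElement_conj_rangeProj]
        simp only [List.append_nil]
    _ = 1 := by rw [Equiv.sum_comp σ fun μ => rangeProj S μ.toList, hS.sum_rangeProj]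

theorem star_permElement (S : Fin n → A) {k : ℕ} (σ : Equiv.Perm (List.Vector (Fin n) k)) :
    star (permElement S σ) = permElement S σ⁻¹ := by
  rw [permElement, permElement,
    ← Equiv.sum_comp σ fun μ => word S (σ⁻¹ μ).toList * star (word S μ.toList)]
  simp

theorem IsCuntzFamily.isPermUnitary_permElement (hS : IsCuntzFamily S) {k : ℕ}
    (σ : Equiv.Perm (List.Vector (Fin n) k)) : IsPermUnitary S (permElement S σ) := by
  refine ⟨Unitary.mem_iff.2 ⟨?_, hS.permElement_mul_star σ⟩, k, permElement_mem_permLevel S σ⟩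
  have h := hS.permElement_mul_star σ⁻¹
  rwa [← star_permElement, star_star] at h

theorem exists_matrixMap_of_mem_permLevel {k : ℕ} {x : A} (hx : x ∈ permLevel S k) :
    ∃ N : List.Vector (Fin n) k → List.Vector (Fin n) k → ℕ,
      x = matrixMap S k (Matrix.of fun μ ν => (N μ ν : ℂ)) := by
  induction hx using AddSubmonoid.closure_induction with
  | mem x hx =>
    obtain ⟨μ, ν, hμ, hν, rfl⟩ := hx
    obtain ⟨μ, rfl⟩ : ∃ μ' : List.Vector (Fin n) k, μ'.toList = μ := ⟨⟨μ, hμ⟩, rfl⟩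
    obtain ⟨ν, rfl⟩ : ∃ ν' : List.Vector (Fin n) k, ν'.toList = ν := ⟨⟨ν, hν⟩, rfl⟩
    refine ⟨fun a b => if a = μ ∧ b = ν then 1 else 0, ?_⟩
    rw [matrixMap, Fintype.sum_eq_single μ, Fintype.sum_eq_single ν]
    · simp
    · intro b hb
      simp [hb]
    · intro b hb
      simp [hb]
  | zero => exact ⟨0, by simp [matrixMap]⟩
  | add x y _ _ h1 h2 =>
    obtain ⟨N, rfl⟩ := h1
    obtain ⟨N', rfl⟩ := h2
    exact ⟨N + N', by simp [matrixMap, add_smul, Finset.sum_add_distrib]⟩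

/-- The coefficients of `u` are natural numbers, and independence of the matrix units turns
unitarity of `u` into unitarity of its coefficient matrix, which must be a permutation matrix. -/
theorem IsCuntzFamily.exists_permElement [Nontrivial A] (hS : IsCuntzFamily S) {k : ℕ} {u : A}
    (hu : u ∈ unitary A) (hk : u ∈ permLevel S k) :
    ∃ σ : Equiv.Perm (List.Vector (Fin n) k), u = permElement S σ := by
  obtain ⟨N, rfl⟩ := exists_matrixMap_of_mem_permLevel hk
  set m : Matrix (List.Vector (Fin n) k) (List.Vector (Fin n) k) ℂ :=
    Matrix.of fun μ ν => (N μ ν : ℂ) with hm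
  have h1 : star m * m = 1 := by
    refine hS.matrixHom_injective k ?_
    rw [map_mul, map_star, map_one]
    exact Unitary.star_mul_self_of_mem hu
  have h2 (μ ν) : ∑ κ, N κ μ * N κ ν = if μ = ν then 1 else 0 := by
    have h3 := congrFun (congrFun h1 μ) ν
    simp only [Matrix.mul_apply, Matrix.star_apply, hm, Matrix.of_apply, star_natCast,
      Matrix.one_apply] at h3
    exact_mod_cast h3
  obtain ⟨σ, hσ⟩ := exists_perm_of_sum_mul_eq h2
  refine ⟨σ, ?_⟩
  rw [matrixMap, Finset.sum_comm, permElement]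
  refine Finset.sum_congr rfl fun μ _ => ?_
  rw [Fintype.sum_eq_single (σ μ)]
  · simp [hm, hσ]
  · intro κ hκ
    simp [hm, hσ, hκ]

/-- The gauge mean fixes `u ∈ 𝓕ₙ` and deletes the words with `|μ| ≠ |ν|` from its expansion; the
remaining words can be brought to a common length. -/
theorem IsCuntzAlgebra.mem_permUnitaries_iff [Nontrivial A] (hn : 2 ≤ n) (hS : IsCuntzAlgebra S)
    {u : A} : u ∈ permUnitaries S ↔ IsPermUnitary S u := by
  constructor
  · rintro ⟨⟨hu, m, μ, ν, h⟩, hcore⟩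
    refine ⟨hu, ?_⟩
    rw [← ((isGaugeInvariant_iff_mem_core (hn := hn) (hS := hS)).2 hcore).gaugeMean_eq, h,
      gaugeMean_sum]
    refine hS.isCuntzFamily.exists_permLevel_sum fun j _ => ?_
    rw [gaugeMean_word]
    split_ifs with hj
    · exact ⟨_, word_mem_permLevel S rfl hj.symm⟩
    · exact ⟨0, zero_mem _⟩
  · rintro ⟨hu, k, hk⟩
    refine ⟨⟨hu, ?_⟩, subset_closure (Set.mem_iUnion.2 ⟨k, permLevel_le_matrixLevel S k hk⟩)⟩
    obtain ⟨σ, rfl⟩ := hS.isCuntzFamily.exists_permElement hu hk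
    let e := Fintype.equivFin (List.Vector (Fin n) k)
    refine ⟨_, fun j => (σ (e.symm j)).toList, fun j => (e.symm j).toList, ?_⟩
    rw [permElement, ← e.symm.sum_comp]

end PermutationMatrices

/-! ### The diagonal: cylinders, projections, maximality in the core. -/

section Diagonal

variable {A : Type*} [CStarAlgebra A] {n : ℕ} {S : Fin n → A}

theorem isClosed_diagonal (S : Fin n → A) : IsClosed (diagonal S : Set A) :=
  StarSubalgebra.isClosed_topologicalClosure _

instance (S : Fin n → A) : IsClosed (diagonal S : Set A) := isClosed_diagonal S

theorem rangeProj_mem_diagonal (S : Fin n → A) (μ : List (Fin n)) : rangeProj S μ ∈ diagonal S :=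
  StarSubalgebra.le_topologicalClosure _ (StarAlgebra.subset_adjoin ℂ _ ⟨μ, rfl⟩)

/-- The span of the range projections of the words of length `k`. -/
def diagLevel (S : Fin n → A) (k : ℕ) : Submodule ℂ A :=
  Submodule.span ℂ (Set.range fun μ : List.Vector (Fin n) k => rangeProj S μ.toList)

theorem IsCuntzFamily.rangeProj_eq_sum (hS : IsCuntzFamily S) (μ : List (Fin n)) (d : ℕ) :
    rangeProj S μ = ∑ κ : List.Vector (Fin n) d, rangeProj S (μ ++ κ.toList) :=
  hS.word_mul_star_word_eq_sum μ μ d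

theorem rangeProj_mem_diagLevel (S : Fin n → A) {k : ℕ} {μ : List (Fin n)} (hμ : μ.length = k) :
    rangeProj S μ ∈ diagLevel S k :=
  Submodule.subset_span ⟨⟨μ, hμ⟩, rfl⟩

theorem IsCuntzFamily.rangeProj_mem_diagLevel_of_le (hS : IsCuntzFamily S) {k : ℕ}
    {μ : List (Fin n)} (hμ : μ.length ≤ k) : rangeProj S μ ∈ diagLevel S k := by
  rw [hS.rangeProj_eq_sum μ (k - μ.length)]
  exact sum_mem fun κ _ => rangeProj_mem_diagLevel S (by simp [hμ])

theorem IsCuntzFamily.diagLevel_mono (hS : IsCuntzFamily S) {j k : ℕ} (h : j ≤ k) :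
    diagLevel S j ≤ diagLevel S k := by
  refine Submodule.span_le.2 ?_
  rintro _ ⟨μ, rfl⟩
  exact hS.rangeProj_mem_diagLevel_of_le (by simpa using h)

theorem IsCuntzFamily.mul_mem_diagLevel (hS : IsCuntzFamily S) {k : ℕ} {x y : A}
    (hx : x ∈ diagLevel S k) (hy : y ∈ diagLevel S k) :
    x * y ∈ diagLevel S k ∧ x * y = y * x := by
  induction hx, hy using Submodule.span_induction₂ with
  | mem_mem x y hx hy =>
    obtain ⟨μ, rfl⟩ := hx
    obtain ⟨ν, rfl⟩ := hy
    simp only [hS.rangeProj_vector_mul]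
    by_cases h : μ = ν
    · simp only [h, if_true]
      exact ⟨Submodule.subset_span ⟨ν, rfl⟩, trivial⟩
    · simp [h, Ne.symm h]
  | zero_left => simp
  | zero_right => simp
  | add_left x y z _ _ _ h1 h2 =>
    rw [add_mul, mul_add, h1.2, h2.2]
    exact ⟨add_mem (h1.2 ▸ h1.1) (h2.2 ▸ h2.1), rfl⟩
  | add_right x y z _ _ _ h1 h2 =>
    rw [add_mul, mul_add, ← h1.2, ← h2.2]
    exact ⟨add_mem h1.1 h2.1, rfl⟩
  | smul_left c x y _ _ h =>
    rw [smul_mul_assoc, mul_smul_comm, ← h.2]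
    exact ⟨Submodule.smul_mem _ c h.1, rfl⟩
  | smul_right c x y _ _ h =>
    rw [smul_mul_assoc, mul_smul_comm, ← h.2]
    exact ⟨Submodule.smul_mem _ c h.1, rfl⟩

theorem star_mem_diagLevel {k : ℕ} {x : A} (hx : x ∈ diagLevel S k) : star x ∈ diagLevel S k := by
  induction hx using Submodule.span_induction with
  | mem x hx =>
    obtain ⟨μ, rfl⟩ := hx
    rw [star_rangeProj]
    exact Submodule.subset_span ⟨μ, rfl⟩
  | zero => simp
  | add x y _ _ h1 h2 => rw [star_add]; exact add_mem h1 h2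
  | smul c x _ h => rw [star_smul]; exact Submodule.smul_mem _ _ h

theorem IsCuntzFamily.adjoin_rangeProj_le (hS : IsCuntzFamily S) {x : A}
    (hx : x ∈ StarAlgebra.adjoin ℂ (Set.range (rangeProj S))) : ∃ k, x ∈ diagLevel S k := by
  induction hx using StarAlgebra.adjoin_induction with
  | mem x hx =>
    obtain ⟨μ, rfl⟩ := hx
    exact ⟨_, rangeProj_mem_diagLevel S rfl⟩
  | algebraMap r =>
    refine ⟨0, ?_⟩
    rw [Algebra.algebraMap_eq_smul_one, ← hS.sum_rangeProj 0]
    exact Submodule.smul_mem _ r (sum_mem fun μ _ => Submodule.subset_span ⟨μ, rfl⟩)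
  | add x y _ _ h1 h2 =>
    obtain ⟨j, hj⟩ := h1
    obtain ⟨k, hk⟩ := h2
    exact ⟨max j k, add_mem (hS.diagLevel_mono (le_max_left j k) hj)
      (hS.diagLevel_mono (le_max_right j k) hk)⟩
  | mul x y _ _ h1 h2 =>
    obtain ⟨j, hj⟩ := h1
    obtain ⟨k, hk⟩ := h2
    exact ⟨max j k, (hS.mul_mem_diagLevel (hS.diagLevel_mono (le_max_left j k) hj)
      (hS.diagLevel_mono (le_max_right j k) hk)).1⟩
  | star x _ h => exact h.imp fun _ => star_mem_diagLevel

theorem IsCuntzFamily.exists_diagLevel_norm_sub_lt (hS : IsCuntzFamily S) {x : A}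
    (hx : x ∈ diagonal S) {ε : ℝ} (hε : 0 < ε) : ∃ k, ∃ y ∈ diagLevel S k, ‖x - y‖ < ε := by
  obtain ⟨y, hy, hxy⟩ := Metric.mem_closure_iff.1 hx ε hε
  obtain ⟨k, hk⟩ := hS.adjoin_rangeProj_le hy
  exact ⟨k, y, hk, by rwa [← dist_eq_norm]⟩

/-- A closed subspace that contains the range projections of all words of length at least `K`
contains the diagonal. -/
theorem IsCuntzFamily.diagonal_subset (hS : IsCuntzFamily S) (K : ℕ) {V : Submodule ℂ A}
    (hV : IsClosed (V : Set A)) (h : ∀ μ : List (Fin n), K ≤ μ.length → rangeProj S μ ∈ V) {x : A}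
    (hx : x ∈ diagonal S) : x ∈ V := by
  refine closure_minimal (fun y hy => ?_) hV hx
  obtain ⟨k, hk⟩ := hS.adjoin_rangeProj_le hy
  have hle : diagLevel S (max K k) ≤ V := by
    refine Submodule.span_le.2 ?_
    rintro _ ⟨μ, rfl⟩
    exact h _ (by simp)
  exact hle (hS.diagLevel_mono (le_max_right K k) hk)

/-- Continuous linear maps that agree on the range projections of all words of length at least `K`
agree on the diagonal. -/
theorem IsCuntzFamily.diagonal_eq {B : Type*} [CStarAlgebra B] (hS : IsCuntzFamily S) (K : ℕ)
    {f g : A →ₗ[ℂ] B} (hf : Continuous f) (hg : Continuous g)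
    (h : ∀ μ : List (Fin n), K ≤ μ.length → f (rangeProj S μ) = g (rangeProj S μ)) {x : A}
    (hx : x ∈ diagonal S) : f x = g x :=
  hS.diagonal_subset K (V := LinearMap.eqLocus f g) (isClosed_eq hf hg) h hx

theorem IsCuntzFamily.diagonal_eq_of_rangeProj {B : Type*} [CStarAlgebra B] (hS : IsCuntzFamily S)
    (K : ℕ) {f g : diagonal S →ₗ[ℂ] B} (hf : Continuous f) (hg : Continuous g)
    (h : ∀ μ : List (Fin n), K ≤ μ.length → f ⟨rangeProj S μ, rangeProj_mem_diagonal S μ⟩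
      = g ⟨rangeProj S μ, rangeProj_mem_diagonal S μ⟩) (x : diagonal S) : f x = g x := by
  let ι : diagonal S →ₗ[ℂ] A := (diagonal S).subtype.toAlgHom.toLinearMap
  -- The maps live only on the diagonal, so their equalizer is pushed into `A`; it stays closed
  -- because the diagonal is closed.
  have hcl : IsClosed ((LinearMap.eqLocus f g).map ι : Set A) := by
    rw [Submodule.map_coe]
    exact (isClosed_diagonal S).isClosedEmbedding_subtypeVal.isClosedMap _ (isClosed_eq hf hg)
  obtain ⟨y, hy, hyx⟩ := hS.diagonal_subset K hcl (fun μ hμ => ⟨_, h μ hμ, rfl⟩) x.2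
  obtain rfl : y = x := Subtype.ext hyx
  exact hy

/-- The map `x ↦ a x b`. -/
def sandwich (a b : A) : A →ₗ[ℂ] A := LinearMap.mulRight ℂ b ∘ₗ LinearMap.mulLeft ℂ a

theorem sandwich_apply (a b x : A) : sandwich a b x = a * x * b := rfl

theorem continuous_sandwich (a b : A) : Continuous (sandwich a b) := by
  change Continuous fun x => a * x * b
  fun_prop

theorem IsCuntzFamily.rangeProj_commute (hS : IsCuntzFamily S) (μ ν : List (Fin n)) :
    rangeProj S μ * rangeProj S ν = rangeProj S ν * rangeProj S μ :=
  (hS.mul_mem_diagLevel (hS.rangeProj_mem_diagLevel_of_le (le_max_left μ.length ν.length))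
    (hS.rangeProj_mem_diagLevel_of_le (le_max_right μ.length ν.length))).2

theorem IsCuntzFamily.commute_of_commute_rangeProj (hS : IsCuntzFamily S) (K : ℕ) {y : A}
    (hy : ∀ μ : List (Fin n), K ≤ μ.length → rangeProj S μ * y = y * rangeProj S μ) {x : A}
    (hx : x ∈ diagonal S) : x * y = y * x :=
  hS.diagonal_eq K (f := LinearMap.mulRight ℂ y) (g := LinearMap.mulLeft ℂ y)
    (continuous_mul_const y) (continuous_const_mul y) hy hx

theorem IsCuntzFamily.diagonal_commute (hS : IsCuntzFamily S) {x y : A} (hx : x ∈ diagonal S)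
    (hy : y ∈ diagonal S) : x * y = y * x :=
  hS.commute_of_commute_rangeProj 0 (fun μ _ =>
    (hS.commute_of_commute_rangeProj 0 (fun ν _ => hS.rangeProj_commute ν μ) hy).symm) hx

theorem IsCuntzAlgebra.shift_iterate_mem_diagonal (hS : IsCuntzAlgebra S) (k : ℕ) {x : A}
    (hx : x ∈ diagonal S) : (shift S)^[k] x ∈ diagonal S := by
  induction k with
  | zero => exact hx
  | succ k ih => rw [Function.iterate_succ_apply']; exact shift_mem_diagonal hS ih

theorem IsCuntzAlgebra.generator_mul_mem_diagonal (hS : IsCuntzAlgebra S) (i : Fin n) {x : A}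
    (hx : x ∈ diagonal S) : S i * x * star (S i) ∈ diagonal S := by
  have h : S i * x * star (S i) = rangeProj S [i] * shift S x := by
    simp [rangeProj, mul_assoc, hS.isCuntzFamily.star_mul_shift]
  rw [h]
  exact mul_mem (rangeProj_mem_diagonal S _) (shift_mem_diagonal hS hx)

theorem norm_eq_one_of_projection {p : A} (h1 : star p = p) (h2 : p * p = p) (h0 : p ≠ 0) :
    ‖p‖ = 1 := by
  have h := CStarRing.norm_star_mul_self (x := p)
  rw [h1, h2] at h
  exact mul_left_cancel₀ (norm_ne_zero_iff.2 h0) (by rw [← h, mul_one])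

theorem norm_le_one_of_projection {p : A} (h1 : star p = p) (h2 : p * p = p) : ‖p‖ ≤ 1 := by
  by_cases h0 : p = 0
  · simp [h0]
  · exact (norm_eq_one_of_projection h1 h2 h0).le

/-- Commuting projections at distance less than one are equal. -/
theorem eq_of_projection_of_norm_sub_lt {p q : A} (hp : star p = p) (hp2 : p * p = p)
    (hq : star q = q) (hq2 : q * q = q) (hpq : p * q = q * p) (h : ‖p - q‖ < 1) : p = q := by
  have key {p q : A} (hp : star p = p) (hp2 : p * p = p)
      (hq : star q = q) (hq2 : q * q = q) (hpq : p * q = q * p) (h : ‖p - q‖ < 1) :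
      p = p * q := by
    by_contra hne
    -- For commuting projections `p - p q` is a projection, of norm one unless zero, while this
    -- identity bounds its norm by `‖p - q‖ < 1`.
    have h1 : p * (p - q) = p - p * q := by rw [mul_sub, hp2]
    have h2 : ‖p - p * q‖ = 1 := by
      refine norm_eq_one_of_projection ?_ ?_ (sub_ne_zero.2 hne)
      · rw [star_sub, star_mul, hp, hq, hpq]
      · have h3 : p * (p * q) = p * q := by rw [← mul_assoc, hp2]
        have h4 : p * q * p = p * q := by rw [hpq, mul_assoc, hp2]
        have h5 : p * q * (p * q) = p * q := by rw [← mul_assoc, h4, mul_assoc, hq2]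
        rw [mul_sub, sub_mul, sub_mul, hp2, h3, h4, h5]
        simp
    rw [← h1] at h2
    have h3 := norm_mul_le p (p - q)
    have h4 := norm_le_one_of_projection hp hp2
    nlinarith [norm_nonneg p, norm_nonneg (p - q)]
  rw [key hp hp2 hq hq2 hpq h, hpq, ← key hq hq2 hp hp2 hpq.symm (by rwa [norm_sub_rev])]

/-- A projection in the diagonal is eventually constant on cylinders. -/
theorem IsCuntzFamily.exists_level_of_projection (hS : IsCuntzFamily S) {p : A}
    (hp : p ∈ diagonal S) (h1 : star p = p) (h2 : p * p = p) :
    ∃ K, ∀ k ≥ K, ∀ μ : List.Vector (Fin n) k,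
      p * rangeProj S μ.toList = 0 ∨ p * rangeProj S μ.toList = rangeProj S μ.toList := by
  obtain ⟨K, y, hy, hlt⟩ := hS.exists_diagLevel_norm_sub_lt hp (half_pos one_pos)
  refine ⟨K, fun k hk μ => ?_⟩
  obtain ⟨c, rfl⟩ := Submodule.mem_span_range_iff_exists_fun ℂ |>.1 (hS.diagLevel_mono hk hy)
  set P := rangeProj S μ.toList with hP
  have hPs : star P = P := star_rangeProj S _
  have hPP : P * P = P := hS.rangeProj_mul_self _
  have hcomm : p * P = P * p := hS.diagonal_commute hp (rangeProj_mem_diagonal S _)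
  have hyP : (∑ i, c i • rangeProj S i.toList) * P = c μ • P := by
    simp [Finset.sum_mul, hP, hS.rangeProj_vector_mul]
  set y := ∑ i, c i • rangeProj S i.toList
  have hnP : ‖P‖ ≤ 1 := norm_le_one_of_projection hPs hPP
  have hbound : ‖p * P - c μ • P‖ < 1 / 2 := by
    rw [← hyP, ← sub_mul]
    exact ((norm_mul_le _ _).trans (mul_le_of_le_one_right (norm_nonneg _) hnP)).trans_lt hlt
  by_contra! hne
  have hq : ‖p * P‖ = 1 := by
    refine norm_eq_one_of_projection ?_ ?_ hne.1
    · rw [star_mul, h1, hPs, hcomm]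
    · rw [← mul_assoc, mul_assoc p P p, ← hcomm, ← mul_assoc, h2, mul_assoc, hPP]
  have hr : ‖P - p * P‖ = 1 := by
    refine norm_eq_one_of_projection ?_ ?_ (sub_ne_zero.2 hne.2.symm)
    · rw [star_sub, star_mul, h1, hPs, hcomm]
    · have h3 : P * (p * P) = p * P := by rw [← mul_assoc, ← hcomm, mul_assoc, hPP]
      have h4 : p * P * P = p * P := by rw [mul_assoc, hPP]
      have h5 : p * P * (p * P) = p * P := by rw [mul_assoc, h3, ← mul_assoc, h2]
      rw [mul_sub, sub_mul, sub_mul, hPP, h3, h4, h5]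
      simp
  -- If `p` cut the cylinder `P` properly, the coefficient `c μ` of the approximant would be within
  -- `1/2` of `1` on `p P` and within `1/2` of `0` on `P - p P`.
  have h6 : p * (p * P - c μ • P) = (1 - c μ) • (p * P) := by
    rw [mul_sub, ← mul_assoc, h2, mul_smul_comm, sub_smul, one_smul]
  have h7 : (1 - p) * (p * P - c μ • P) = (-c μ) • (P - p * P) := by
    rw [sub_mul, h6, one_mul, sub_smul, one_smul, neg_smul, smul_sub]
    abel
  have hnp : ‖p‖ ≤ 1 := norm_le_one_of_projection h1 h2
  have hnp' : ‖1 - p‖ ≤ 1 := by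
    refine norm_le_one_of_projection (by rw [star_sub, star_one, h1]) ?_
    rw [mul_sub, mul_one, sub_mul, one_mul, h2, sub_self, sub_zero]
  have h8 : ‖1 - c μ‖ < 1 / 2 := by
    have h := (norm_mul_le p (p * P - c μ • P)).trans (mul_le_of_le_one_left (norm_nonneg _) hnp)
    rw [h6, norm_smul, hq, mul_one] at h
    exact h.trans_lt hbound
  have h9 : ‖c μ‖ < 1 / 2 := by
    have h := (norm_mul_le (1 - p) (p * P - c μ • P)).trans
      (mul_le_of_le_one_left (norm_nonneg _) hnp')
    rw [h7, norm_smul, hr, mul_one, norm_neg] at h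
    exact h.trans_lt hbound
  have h10 : ‖(1 : ℂ)‖ ≤ ‖1 - c μ‖ + ‖c μ‖ := by
    simpa using norm_add_le (1 - c μ) (c μ)
  rw [norm_one] at h10
  linarith

/-- The block diagonal embedding of `A ^ (n ^ k)` given by the words of length `k`. -/
def IsCuntzFamily.blockHom (hS : IsCuntzFamily S) (k : ℕ) :
    (List.Vector (Fin n) k → A) →⋆ₐ[ℂ] A where
  toFun a := ∑ μ, word S μ.toList * a μ * star (word S μ.toList)
  map_one' := by simpa [rangeProj] using hS.sum_rangeProj k
  map_zero' := by simp
  map_add' x y := by simp [mul_add, add_mul, Finset.sum_add_distrib]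
  map_mul' x y := by
    simp only [Finset.sum_mul_sum]
    refine Finset.sum_congr rfl fun μ _ => ?_
    rw [Fintype.sum_eq_single μ]
    · calc word S μ.toList * (x * y) μ * star (word S μ.toList)
          = word S μ.toList * x μ * 1 * y μ * star (word S μ.toList) := by simp [mul_assoc]
        _ = _ := by rw [← hS.star_word_mul_self μ.toList]; simp only [mul_assoc]
    · intro ν hν
      calc word S μ.toList * x μ * star (word S μ.toList) *
            (word S ν.toList * y ν * star (word S ν.toList))
          = word S μ.toList * x μ * (star (word S μ.toList) * word S ν.toList) * y ν *
            star (word S ν.toList) := by simp only [mul_assoc]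
        _ = 0 := by rw [hS.star_vector_mul, if_neg hν.symm]; simp
  commutes' c := by
    simp only [Pi.algebraMap_apply, Algebra.algebraMap_eq_smul_one, mul_smul_comm, smul_mul_assoc,
      mul_one, ← Finset.smul_sum]
    rw [← hS.sum_rangeProj k]
    rfl
  map_star' x := by simp [mul_assoc]

theorem norm_word_le (hS : IsCuntzFamily S) (μ : List (Fin n)) : ‖word S μ‖ ≤ 1 :=
  norm_le_one_of_star_mul_self (hS.star_word_mul_self μ)

/-- The pinching is the image under a block diagonal *-homomorphism of the tuple of corners `S_μ^* z
S_μ`, each of norm at most `‖z‖`. -/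
theorem IsCuntzFamily.norm_sum_rangeProj_le (hS : IsCuntzFamily S) (k : ℕ) (z : A) :
    ‖∑ μ : List.Vector (Fin n) k, rangeProj S μ.toList * z * rangeProj S μ.toList‖ ≤ ‖z‖ := by
  have h := NonUnitalStarAlgHom.norm_apply_le (hS.blockHom k)
    fun μ => star (word S μ.toList) * z * word S μ.toList
  have h1 : hS.blockHom k (fun μ => star (word S μ.toList) * z * word S μ.toList)
      = ∑ μ : List.Vector (Fin n) k, rangeProj S μ.toList * z * rangeProj S μ.toList := by
    change ∑ μ : List.Vector (Fin n) k, _ = _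
    simp only [rangeProj, mul_assoc]
  rw [h1] at h
  refine h.trans ((pi_norm_le_iff_of_nonneg (norm_nonneg z)).2 fun μ => ?_)
  refine (norm_mul_le _ _).trans <| (mul_le_of_le_one_right (norm_nonneg _)
    (norm_word_le hS _)).trans <| (norm_mul_le _ _).trans <|
    mul_le_of_le_one_left (norm_nonneg _) ?_
  rw [norm_star]
  exact norm_word_le hS _

/-- The diagonal is maximal abelian in the core. -/
theorem IsCuntzFamily.mem_diagonal_of_commute (hS : IsCuntzFamily S) {x : A} (hx : x ∈ core S)
    (hcomm : ∀ μ, rangeProj S μ * x = x * rangeProj S μ) : x ∈ diagonal S := by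
  refine (isClosed_diagonal S).closure_subset (Metric.mem_closure_iff.2 fun ε hε => ?_)
  obtain ⟨y, hy, hxy⟩ := Metric.mem_closure_iff.1 hx ε hε
  obtain ⟨k, hk⟩ := Set.mem_iUnion.1 hy
  -- Pinching by the cylinders of level `k` sends the approximant `y` into the diagonal and fixes
  -- `x`, which commutes with them; being contractive, it keeps the two close.
  refine ⟨∑ μ : List.Vector (Fin n) k, rangeProj S μ.toList * y * rangeProj S μ.toList, ?_, ?_⟩
  · have hle : matrixLevel S k ≤ (diagonal S).toSubalgebra.toSubmodule.comap
        (∑ μ : List.Vector (Fin n) k, sandwich (rangeProj S μ.toList) (rangeProj S μ.toList)) := by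
      refine Submodule.span_le.2 ?_
      rintro _ ⟨μ, ν, hμ, hν, rfl⟩
      rw [SetLike.mem_coe, Submodule.mem_comap, LinearMap.sum_apply]
      refine sum_mem fun κ _ => ?_
      have h : sandwich (rangeProj S κ.toList) (rangeProj S κ.toList)
          (word S μ * star (word S ν)) = word S κ.toList *
            (star (word S κ.toList) * word S μ) * (star (word S ν) * word S κ.toList) *
            star (word S κ.toList) := by
        simp only [sandwich_apply, rangeProj, mul_assoc]
      rw [h, hS.star_word_mul_word (by simp [hμ]), hS.star_word_mul_word (by simp [hν])]
      split_ifs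
      · simpa [rangeProj] using rangeProj_mem_diagonal S κ.toList
      all_goals simp
    have h := hle hk
    rw [Submodule.mem_comap, LinearMap.sum_apply] at h
    exact h
  · have h : x = ∑ μ : List.Vector (Fin n) k, rangeProj S μ.toList * x * rangeProj S μ.toList := by
      conv_lhs => rw [← mul_one x, ← hS.sum_rangeProj k, Finset.mul_sum]
      refine Finset.sum_congr rfl fun μ _ => ?_
      rw [hcomm, mul_assoc, hS.rangeProj_mul_self]
    rw [dist_eq_norm]
    conv_lhs => rw [h, ← Finset.sum_sub_distrib]
    simp only [← sub_mul, ← mul_sub]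
    refine (hS.norm_sum_rangeProj_le k (x - y)).trans_lt ?_
    rwa [← dist_eq_norm]

end Diagonal

/-! ### Permutative endomorphisms: action on the diagonal and rigidity. -/

section PermutativeEndomorphisms

variable {A : Type*} [CStarAlgebra A] {n : ℕ} {S : Fin n → A}

theorem map_generator_mul {f : A →⋆ₐ[ℂ] A} {u : A} (hf : ∀ i, f (S i) = u * S i) (i j : Fin n)
    (x : A) : f (S i * x * star (S j)) = u * (S i * f x * star (S j)) * star u := by
  simp only [map_mul, map_star, hf, star_mul, mul_assoc]

theorem map_shift {f : A →⋆ₐ[ℂ] A} {u : A} (hf : ∀ i, f (S i) = u * S i) (x : A) :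
    f (shift S x) = u * shift S (f x) * star u := by
  simp only [shift, map_sum, map_generator_mul hf, Finset.mul_sum, Finset.sum_mul]

theorem rangeProj_cons (S : Fin n → A) (i : Fin n) (μ : List (Fin n)) :
    rangeProj S (i :: μ) = S i * rangeProj S μ * star (S i) := by
  simp [rangeProj, mul_assoc]

theorem exists_vector_append {k : ℕ} {μ : List (Fin n)} (h : k ≤ μ.length) :
    ∃ (ν : List.Vector (Fin n) k) (τ : List (Fin n)), μ = ν.toList ++ τ :=
  ⟨⟨μ.take k, by simp [h]⟩, μ.drop k, (List.take_append_drop k μ).symm⟩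

theorem IsPermUnitary.conj_mem_diagonal [Nontrivial A] (hS : IsCuntzFamily S) {u : A}
    (hu : IsPermUnitary S u) {x : A} (hx : x ∈ diagonal S) : u * x * star u ∈ diagonal S := by
  obtain ⟨hu, k, hk⟩ := hu
  obtain ⟨σ, rfl⟩ := hS.exists_permElement hu hk
  refine hS.diagonal_subset k (V := (diagonal S).toSubalgebra.toSubmodule.comap
    (sandwich (permElement S σ) (star (permElement S σ))))
    ((isClosed_diagonal S).preimage (continuous_sandwich _ _)) (fun μ hμ => ?_) hx
  obtain ⟨ν, τ, rfl⟩ := exists_vector_append hμ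
  change permElement S σ * rangeProj S (ν.toList ++ τ) * star (permElement S σ) ∈ diagonal S
  rw [hS.permElement_conj_rangeProj]
  exact rangeProj_mem_diagonal S _

/-- At a level beyond both `K` and that of `u`, the permutation must send each cylinder to itself.
-/
theorem IsPermUnitary.eq_one_of_commute [Nontrivial A] (hS : IsCuntzFamily S) {u : A}
    (hu : IsPermUnitary S u) (K : ℕ)
    (hcomm : ∀ μ : List (Fin n), K ≤ μ.length → u * rangeProj S μ = rangeProj S μ * u) :
    u = 1 := by
  obtain ⟨hu, k, hk⟩ := hu
  obtain ⟨σ, rfl⟩ := hS.exists_permElement hu (hS.permLevel_mono (le_max_right K k) hk)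
  have hσ (μ) : σ μ = μ := by
    have h1 := hS.permElement_conj_rangeProj σ μ []
    rw [List.append_nil, List.append_nil, hcomm _ (by simp), mul_assoc,
      Unitary.mul_star_self_of_mem hu, mul_one] at h1
    by_contra hne
    have h2 := hS.rangeProj_vector_mul (σ μ) μ
    rw [if_neg hne, ← h1, hS.rangeProj_mul_self] at h2
    exact hS.rangeProj_ne_zero _ h2
  rw [← hS.sum_rangeProj (max K k), permElement]
  simp only [hσ, rangeProj]

theorem map_rangeProj_mem_diagonal [Nontrivial A] (hS : IsCuntzAlgebra S) {f : A →⋆ₐ[ℂ] A} {u : A}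
    (hu : IsPermUnitary S u) (hf : ∀ i, f (S i) = u * S i) (μ : List (Fin n)) :
    f (rangeProj S μ) ∈ diagonal S := by
  induction μ with
  | nil => simp [rangeProj]
  | cons i μ ih =>
    rw [rangeProj_cons, map_generator_mul hf]
    exact hu.conj_mem_diagonal hS.isCuntzFamily (hS.generator_mul_mem_diagonal i ih)

theorem map_mem_diagonal [Nontrivial A] (hS : IsCuntzAlgebra S) {f : A →⋆ₐ[ℂ] A} {u : A}
    (hu : IsPermUnitary S u) (hf : ∀ i, f (S i) = u * S i) {x : A} (hx : x ∈ diagonal S) :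
    f x ∈ diagonal S :=
  hS.isCuntzFamily.diagonal_subset 0
    (V := (diagonal S).toSubalgebra.toSubmodule.comap f.toAlgHom.toLinearMap)
    ((isClosed_diagonal S).preimage (continuous_starAlgHom f))
    (fun μ _ => map_rangeProj_mem_diagonal hS hu hf μ) hx

theorem exists_permLevel_map_word (hS : IsCuntzFamily S) {f : A →⋆ₐ[ℂ] A} {u : A}
    (hu : IsPermUnitary S u) (hf : ∀ i, f (S i) = u * S i) {μ ν : List (Fin n)}
    (h : μ.length = ν.length) : ∃ k, f (word S μ * star (word S ν)) ∈ permLevel S k := by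
  induction μ generalizing ν with
  | nil =>
    obtain rfl : ν = [] := by simpa using h.symm
    simpa using (IsPermUnitary.one S).2
  | cons i μ ih =>
    obtain _ | ⟨j, ν⟩ := ν
    · simp at h
    · have h1 : word S (i :: μ) * star (word S (j :: ν))
          = S i * (word S μ * star (word S ν)) * star (S j) := by simp [mul_assoc]
      rw [h1, map_generator_mul hf]
      obtain ⟨k, hk⟩ := ih (by simpa using h)
      exact hS.exists_permLevel_mul
        (hS.exists_permLevel_mul hu.2 ⟨_, generator_mul_mem_permLevel hk i j⟩) hu.star_mem.2

/-- Needed for composition, since `λ_u λ_v = λ_w` with `w = λ_u(v) u`. -/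
theorem IsPermUnitary.map (hS : IsCuntzFamily S) {f : A →⋆ₐ[ℂ] A} {u v : A}
    (hu : IsPermUnitary S u) (hf : ∀ i, f (S i) = u * S i) (hv : IsPermUnitary S v) :
    IsPermUnitary S (f v) := by
  obtain ⟨hv, k, hk⟩ := hv
  refine ⟨Unitary.map_mem f hv, ?_⟩
  clear hv
  induction hk using AddSubmonoid.closure_induction with
  | mem x hx =>
    obtain ⟨μ, ν, hμ, hν, rfl⟩ := hx
    exact exists_permLevel_map_word hS hu hf (hμ.trans hν.symm)
  | zero => exact ⟨0, by simp⟩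
  | add x y _ _ h1 h2 => rw [map_add]; exact hS.exists_permLevel_add h1 h2

/-- Permutative endomorphisms are determined by their restriction to the diagonal. -/
theorem eq_of_eq_on_diagonal [Nontrivial A] (hS : IsCuntzAlgebra S) {f g : A →⋆ₐ[ℂ] A} {u v : A}
    (hu : IsPermUnitary S u) (hv : IsPermUnitary S v) (hf : ∀ i, f (S i) = u * S i)
    (hg : ∀ i, g (S i) = v * S i) (hfg : ∀ x ∈ diagonal S, f x = g x)
    (hsurj : ∀ y ∈ diagonal S, ∃ x ∈ diagonal S, f x = y) : f = g := by
  -- Surjectivity onto the diagonal gives `P_μ = f x`, and applying both maps to `S_i x S_i^*`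
  -- yields `u P_{iμ} u^* = v P_{iμ} v^*`. Only words with a first letter are reached, hence the
  -- bound `1`.
  have huv : star v * u = 1 := by
    refine (hv.star_mem.mul hS.isCuntzFamily hu).eq_one_of_commute hS.isCuntzFamily 1 fun μ hμ => ?_
    obtain _ | ⟨i, μ⟩ := μ
    · simp at hμ
    obtain ⟨x, hx, hxμ⟩ := hsurj _ (rangeProj_mem_diagonal S μ)
    have h1 := hfg _ (hS.generator_mul_mem_diagonal i hx)
    rw [map_generator_mul hf, map_generator_mul hg, ← hfg x hx, hxμ, ← rangeProj_cons] at h1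
    calc star v * u * rangeProj S (i :: μ)
        = star v * (u * rangeProj S (i :: μ) * star u) * u := by
          simp only [mul_assoc, Unitary.star_mul_self_of_mem hu.1, mul_one]
      _ = (star v * v) * rangeProj S (i :: μ) * (star v * u) := by rw [h1]; simp only [mul_assoc]
      _ = rangeProj S (i :: μ) * (star v * u) := by
          rw [Unitary.star_mul_self_of_mem hv.1, one_mul]
  have huv' : u = v := by
    calc u = v * star v * u := by rw [Unitary.mul_star_self_of_mem hv.1, one_mul]
      _ = v := by rw [mul_assoc, huv, mul_one]
  exact hS.hom_ext fun i => by rw [hf, hg, huv']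

/-- A family of projections in the diagonal that looks like the images of the cylinder projections
of level `K` under an automorphism fixing the range of `φᴷ` is implemented by a permutation. -/
theorem exists_permUnitary_of_projections [Nontrivial A] (hS : IsCuntzAlgebra S) {K : ℕ}
    {q : List.Vector (Fin n) K → A} (hq : ∀ μ, q μ ∈ diagonal S) (hstar : ∀ μ, star (q μ) = q μ)
    (hidem : ∀ μ, q μ * q μ = q μ) (horth : ∀ μ ν, μ ≠ ν → q μ * q ν = 0)
    (hne : ∀ μ κ, q μ * (shift S)^[K] (rangeProj S κ) ≠ 0) :
    ∃ u, IsPermUnitary S u ∧ ∃ d, ∀ (μ : List.Vector (Fin n) K) (κ : List (Fin n)),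
      d ≤ κ.length → u * rangeProj S (μ.toList ++ κ) * star u =
        q μ * (shift S)^[K] (rangeProj S κ) := by
  have hF := hS.isCuntzFamily
  choose L hL using fun μ => hF.exists_level_of_projection (hq μ) (hstar μ) (hidem μ)
  -- At level `K + d` every `q μ` is a union of cylinders.
  let d := Finset.univ.sup L
  have hLd (μ) : L μ ≤ K + d :=
    (Finset.le_sup (f := L) (Finset.mem_univ μ)).trans (Nat.le_add_left _ _)
  have hsplit (ν : List.Vector (Fin n) (K + d)) : ∃ (μ : List.Vector (Fin n) K)
      (κ : List.Vector (Fin n) d), ν.toList = μ.toList ++ κ.toList :=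
    ⟨⟨ν.toList.take K, by simp⟩, ⟨ν.toList.drop K, by simp⟩,
      (List.take_append_drop K ν.toList).symm⟩
  choose hd tl hht using hsplit
  -- These are as many nonzero, mutually orthogonal projections as there are cylinders of level `K +
  -- d`, and each is a union of such cylinders; so each is exactly one cylinder.
  let Q (ν : List.Vector (Fin n) (K + d)) : A :=
    q (hd ν) * (shift S)^[K] (rangeProj S (tl ν).toList)
  let P (ν : List.Vector (Fin n) (K + d)) : A := rangeProj S ν.toList
  have hsumP : ∑ ν, P ν = 1 := hF.sum_rangeProj (K + d)
  have hP0 (ν) : P ν ≠ 0 := hF.rangeProj_ne_zero _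
  have hQP (ν a) : Q ν * P a = 0 ∨ Q ν * P a = P a := by
    have h1 : (shift S)^[K] (rangeProj S (tl ν).toList) * P a = if tl ν = tl a then P a else 0 := by
      simp only [P]
      rw [hht a, rangeProj_append, ← mul_assoc, ← mul_assoc, hF.shift_iterate_mul_vector,
        mul_assoc (word S _), hF.rangeProj_vector_mul]
      split_ifs with h
      · rw [h]
      · simp
    simp only [Q]
    rw [mul_assoc, h1]
    split_ifs
    · exact hL (hd ν) _ (hLd _) a
    · simp
  have hQQ (ν ν') (h : ν ≠ ν') : Q ν * Q ν' = 0 := by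
    have h1 : Q ν * Q ν' = q (hd ν) * q (hd ν') * (shift S)^[K]
        (rangeProj S (tl ν).toList * rangeProj S (tl ν').toList) := by
      simp only [Q]
      rw [hF.shift_iterate_mul, mul_assoc, ← mul_assoc _ (q (hd ν')),
        hF.diagonal_commute (hS.shift_iterate_mem_diagonal K (rangeProj_mem_diagonal S _)) (hq _)]
      simp only [mul_assoc]
    rw [h1, hF.rangeProj_vector_mul]
    by_cases h2 : hd ν = hd ν'
    · have h3 : tl ν ≠ tl ν' := fun h3 => h (List.Vector.toList_injective (by rw [hht, hht, h2, h3]))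
      rw [if_neg h3, shift_iterate_zero, mul_zero]
    · rw [horth _ _ h2, zero_mul]
  have hex (ν) : ∃ a, Q ν * P a = P a := by
    by_contra! h
    refine hne (hd ν) (tl ν).toList ?_
    change Q ν = 0
    rw [← mul_one (Q ν), ← hsumP, Finset.mul_sum]
    exact Finset.sum_eq_zero fun a _ => (hQP ν a).resolve_right (h a)
  choose s hs using hex
  have hinj : Function.Injective s := by
    intro ν ν' h
    by_contra hne'
    refine hP0 (s ν) ?_
    rw [← hs ν, h, ← hs ν', ← mul_assoc, hQQ ν ν' hne', zero_mul]
  let σ : Equiv.Perm (List.Vector (Fin n) (K + d)) :=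
    Equiv.ofBijective s (Finite.injective_iff_bijective.1 hinj)
  have hQs (ν) : Q ν = P (σ ν) := by
    conv_lhs => rw [← mul_one (Q ν), ← hsumP, ← Equiv.sum_comp σ, Finset.mul_sum]
    rw [Fintype.sum_eq_single ν]
    · exact hs ν
    · intro ν' hν'
      change Q ν * P (s ν') = 0
      rw [← hs ν', ← mul_assoc, hQQ ν ν' hν'.symm, zero_mul]
  refine ⟨permElement S σ, hF.isPermUnitary_permElement σ, d, fun μ κ hκ => ?_⟩
  obtain ⟨κ, τ, rfl⟩ := exists_vector_append hκ
  obtain ⟨ν, hν⟩ : ∃ ν : List.Vector (Fin n) (K + d), ν.toList = μ.toList ++ κ.toList :=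
    ⟨⟨μ.toList ++ κ.toList, by simp⟩, rfl⟩
  have h1 : hd ν = μ ∧ tl ν = κ := by
    have h2 := List.append_inj ((hht ν).symm.trans hν) (by simp)
    exact ⟨List.Vector.toList_injective h2.1, List.Vector.toList_injective h2.2⟩
  rw [← List.append_assoc, ← hν, hF.permElement_conj_rangeProj, hF.rangeProj_append_eq_mul,
    List.Vector.toList_length]
  change P (σ ν) * _ = _
  rw [← hQs, hF.rangeProj_append_eq_mul, List.Vector.toList_length, hF.shift_iterate_mul,
    ← Function.iterate_add_apply, ← mul_assoc]
  simp only [Q, h1.1, h1.2]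

end PermutativeEndomorphisms

/-! ### Extending elements of `𝔊` to permutative automorphisms. -/

section Extension

variable {A : Type*} [CStarAlgebra A] {n : ℕ} {S : Fin n → A}

theorem coe_diagShift_iterate (hS : IsCuntzAlgebra S) (m : ℕ) (x : diagonal S) :
    ((diagShift hS)^[m] x : A) = (shift S)^[m] x := by
  induction m with
  | zero => rfl
  | succ m ih =>
    rw [Function.iterate_succ_apply', Function.iterate_succ_apply', ← ih]
    rfl

/-- The map `x ↦ S i x (S i)^*` on the diagonal. -/
def diagSandwich (hS : IsCuntzAlgebra S) (i : Fin n) : diagonal S →ₗ[ℂ] diagonal S where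
  toFun x := ⟨S i * x * star (S i), hS.generator_mul_mem_diagonal i x.2⟩
  map_add' x y := Subtype.ext (by simp [mul_add, add_mul])
  map_smul' c x := Subtype.ext (by simp)

theorem coe_diagSandwich (hS : IsCuntzAlgebra S) (i : Fin n) (x : diagonal S) :
    (diagSandwich hS i x : A) = S i * x * star (S i) := rfl

theorem diagSandwich_mul (hS : IsCuntzAlgebra S) (i j : Fin n) (x y : diagonal S) :
    diagSandwich hS i x * diagSandwich hS j y = if i = j then diagSandwich hS i (x * y) else 0 := by
  refine Subtype.ext ?_
  have h : ((diagSandwich hS i x * diagSandwich hS j y : diagonal S) : A)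
      = S i * x * (star (S i) * S j) * y * star (S j) := by
    simp only [MulMemClass.coe_mul, coe_diagSandwich, mul_assoc]
  rw [h]
  split_ifs with hij
  · rw [← hij, hS.isometry, mul_one, coe_diagSandwich]
    simp only [MulMemClass.coe_mul, mul_assoc]
  · rw [hS.orthogonal hij]
    simp

theorem sum_diagSandwich (hS : IsCuntzAlgebra S) (x : diagonal S) :
    ∑ i, diagSandwich hS i x = diagShift hS x := by
  refine Subtype.ext ?_
  rw [AddSubmonoidClass.coe_finsetSum]
  rfl

theorem star_diagSandwich (hS : IsCuntzAlgebra S) (i : Fin n) (x : diagonal S) :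
    star (diagSandwich hS i x) = diagSandwich hS i (star x) := by
  refine Subtype.ext ?_
  rw [StarMemClass.coe_star, coe_diagSandwich, coe_diagSandwich, StarMemClass.coe_star]
  simp [mul_assoc]

theorem eq_zero_of_diagSandwich_eq_zero (hS : IsCuntzAlgebra S) {i : Fin n} {x : diagonal S}
    (h : diagSandwich hS i x = 0) : x = 0 := by
  refine Subtype.ext ?_
  have h1 : star (S i) * (S i * x * star (S i)) * S i = (x : A) := by
    calc star (S i) * (S i * x * star (S i)) * S i
        = (star (S i) * S i) * x * (star (S i) * S i) := by simp only [mul_assoc]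
      _ = x := by rw [hS.isometry, one_mul, mul_one]
  rw [← h1, ← coe_diagSandwich hS i x, h]
  simp

/-- The range projection as an element of the diagonal. -/
def diagProj (S : Fin n → A) (μ : List (Fin n)) : diagonal S :=
  ⟨rangeProj S μ, rangeProj_mem_diagonal S μ⟩

theorem diagProj_append (hS : IsCuntzAlgebra S) (μ ν : List (Fin n)) :
    diagProj S (μ ++ ν) = diagProj S μ * (diagShift hS)^[μ.length] (diagProj S ν) := by
  refine Subtype.ext ?_
  rw [MulMemClass.coe_mul, coe_diagShift_iterate]
  exact hS.isCuntzFamily.rangeProj_append_eq_mul μ ν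

/-- The map `x ↦ α (S i α⁻¹(x) (S i)^*)` on the diagonal. -/
def conjSandwich (hS : IsCuntzAlgebra S) (α : diagonal S ≃⋆ₐ[ℂ] diagonal S) (i : Fin n) :
    diagonal S →ₗ[ℂ] diagonal S where
  toFun x := α (diagSandwich hS i (α⁻¹ x))
  map_add' x y := by simp
  map_smul' c x := by simp

theorem conjSandwich_apply (hS : IsCuntzAlgebra S) (α : diagonal S ≃⋆ₐ[ℂ] diagonal S) (i : Fin n)
    (x : diagonal S) : conjSandwich hS α i x = α (diagSandwich hS i (α⁻¹ x)) := rfl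

theorem conjSandwich_mul (hS : IsCuntzAlgebra S) (α : diagonal S ≃⋆ₐ[ℂ] diagonal S) (i j : Fin n)
    (x y : diagonal S) : conjSandwich hS α i x * conjSandwich hS α j y =
      if i = j then conjSandwich hS α i (x * y) else 0 := by
  simp only [conjSandwich_apply]
  rw [← map_mul, diagSandwich_mul, apply_ite α, map_mul α⁻¹, map_zero]

theorem apply_inv_apply (α : diagonal S ≃⋆ₐ[ℂ] diagonal S) (x : diagonal S) : α (α⁻¹ x) = x :=
  α.apply_symm_apply x

theorem inv_apply_apply (α : diagonal S ≃⋆ₐ[ℂ] diagonal S) (x : diagonal S) : α⁻¹ (α x) = x :=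
  α.symm_apply_apply x

theorem eq_zero_of_conjSandwich_eq_zero (hS : IsCuntzAlgebra S)
    (α : diagonal S ≃⋆ₐ[ℂ] diagonal S) {i : Fin n} {x : diagonal S}
    (h : conjSandwich hS α i x = 0) : x = 0 := by
  have h1 : diagSandwich hS i (α⁻¹ x) = 0 := EquivLike.injective α (by rw [map_zero]; exact h)
  have h2 := eq_zero_of_diagSandwich_eq_zero hS h1
  rw [← apply_inv_apply α x, h2, map_zero]

/-- The hypothesis gives `φᵐ⁺¹(y) = α φ α⁻¹ φᵐ(y)`, the sum over `j` of the maps `conjSandwich hS α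
j` at `φᵐ(y)`; orthogonality leaves only `j = i`. -/
theorem conjSandwich_mul_shift (hS : IsCuntzAlgebra S) {α : diagonal S ≃⋆ₐ[ℂ] diagonal S} {m : ℕ}
    (hα : Function.Commute (⇑(α⁻¹) ∘ (diagShift hS)^[m]) (diagShift hS)) (i : Fin n)
    (x y : diagonal S) : conjSandwich hS α i x * (diagShift hS)^[m + 1] y =
      conjSandwich hS α i (x * (diagShift hS)^[m] y) := by
  have h1 : (diagShift hS)^[m + 1] y = ∑ j, conjSandwich hS α j ((diagShift hS)^[m] y) := by
    simp only [conjSandwich_apply]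
    rw [← map_sum, sum_diagSandwich]
    have h2 := hα y
    simp only [Function.comp_apply] at h2
    rw [← h2, apply_inv_apply]
    rfl
  rw [h1, Finset.mul_sum]
  simp only [conjSandwich_mul]
  simp

/-- The projections `α(S_i α⁻¹(P_ν) S_i^*)` with `|ν| = m` behave like the cylinders of level `m +
1`, which yields a permutation `u` with `α(S_i x S_i^*) = u S_i α(x) S_i^* u^*`. This is the
recursion of `λ_u`, so induction on words identifies the two on the diagonal. -/
theorem exists_permUnitary_of_commute [Nontrivial A] (hS : IsCuntzAlgebra S)
    {α : diagonal S ≃⋆ₐ[ℂ] diagonal S} {m : ℕ}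
    (hα : Function.Commute (⇑(α⁻¹) ∘ (diagShift hS)^[m]) (diagShift hS)) :
    ∃ u, IsPermUnitary S u ∧ ∀ f : A →⋆ₐ[ℂ] A, (∀ i, f (S i) = u * S i) →
      ∀ x : diagonal S, f x = α x := by
  have hF := hS.isCuntzFamily
  let q (ν : List.Vector (Fin n) (m + 1)) : diagonal S :=
    conjSandwich hS α ν.head (diagProj S ν.tail.toList)
  have hqmul (ν : List.Vector (Fin n) (m + 1)) (κ : List (Fin n)) :
      q ν * (diagShift hS)^[m + 1] (diagProj S κ)
        = conjSandwich hS α ν.head (diagProj S (ν.tail.toList ++ κ)) := by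
    rw [conjSandwich_mul_shift hS hα, diagProj_append hS, List.Vector.toList_length]
    rfl
  have hproj (μ : List (Fin n)) : diagProj S μ * diagProj S μ = diagProj S μ :=
    Subtype.ext (hF.rangeProj_mul_self μ)
  have hstar (μ : List (Fin n)) : star (diagProj S μ) = diagProj S μ :=
    Subtype.ext (star_rangeProj S μ)
  obtain ⟨u, hu, d, hd⟩ := exists_permUnitary_of_projections hS (q := fun ν => (q ν : A))
    (fun ν => (q ν).2)
    (fun ν => by
      rw [← StarMemClass.coe_star]
      simp only [q, conjSandwich_apply]
      rw [← map_star, star_diagSandwich, ← map_star, hstar])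
    (fun ν => by
      rw [← MulMemClass.coe_mul]
      simp only [q]
      rw [conjSandwich_mul, if_pos rfl, hproj])
    (fun ν ν' hne => by
      rw [← MulMemClass.coe_mul]
      simp only [q]
      rw [conjSandwich_mul]
      split_ifs with h
      · have h1 : ν.tail ≠ ν'.tail := fun h1 => hne (by
          rw [← List.Vector.cons_head_tail ν, ← List.Vector.cons_head_tail ν', h, h1])
        have h2 : diagProj S ν.tail.toList * diagProj S ν'.tail.toList = 0 :=
          Subtype.ext ((hF.rangeProj_vector_mul _ _).trans (if_neg h1))
        rw [h2, map_zero]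
        rfl
      · rfl)
    (fun ν κ h => by
      have h1 : q ν * (diagShift hS)^[m + 1] (diagProj S κ) = 0 :=
        Subtype.ext (by rw [MulMemClass.coe_mul, coe_diagShift_iterate]; exact h)
      rw [hqmul] at h1
      have h2 := eq_zero_of_conjSandwich_eq_zero hS α h1
      exact hF.rangeProj_ne_zero _ (congrArg Subtype.val h2))
  refine ⟨u, hu, fun f hf => ?_⟩
  have hcontα : Continuous α := continuous_starAlgHom (α : diagonal S →⋆ₐ[ℂ] diagonal S)
  have hcontα' : Continuous (α⁻¹ : diagonal S ≃⋆ₐ[ℂ] diagonal S) :=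
    continuous_starAlgHom ((α⁻¹ : diagonal S ≃⋆ₐ[ℂ] diagonal S) : diagonal S →⋆ₐ[ℂ] diagonal S)
  let ι : diagonal S →ₗ[ℂ] A := (diagonal S).subtype.toAlgHom.toLinearMap
  have hsand (i : Fin n) : Continuous (diagSandwich hS i) := by
    refine Continuous.subtype_mk ?_ _
    fun_prop
  -- The identity is known for words `i ν τ` with `|ν| = m` and `|τ| ≥ d`; cylinders of length at
  -- least `m + d` span a dense subspace of the diagonal.
  have hβ (i : Fin n) (x : diagonal S) :
      u * (S i * x * star (S i)) * star u = (conjSandwich hS α i x : A) := by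
    refine hF.diagonal_eq_of_rangeProj (m + d)
      (f := sandwich u (star u) ∘ₗ ι ∘ₗ diagSandwich hS i) (g := ι ∘ₗ conjSandwich hS α i)
      ((continuous_sandwich _ _).comp (continuous_subtype_val.comp (hsand i)))
      (continuous_subtype_val.comp (hcontα.comp ((hsand i).comp hcontα'))) (fun μ hμ => ?_) x
    obtain ⟨ν, τ, rfl⟩ := exists_vector_append (k := m) (by omega : m ≤ μ.length)
    have h1 := hd (i ::ᵥ ν) τ (by simp at hμ; omega)
    rw [List.Vector.toList_cons, List.cons_append, rangeProj_cons] at h1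
    refine h1.trans ?_
    have h2 := congrArg Subtype.val (hqmul (i ::ᵥ ν) τ)
    rw [MulMemClass.coe_mul, coe_diagShift_iterate] at h2
    exact h2
  have hα' (i : Fin n) (x : diagonal S) :
      (α (diagSandwich hS i x) : A) = u * (S i * α x * star (S i)) * star u := by
    rw [hβ, conjSandwich_apply, inv_apply_apply]
  have hP (μ : List (Fin n)) : f (rangeProj S μ) = α (diagProj S μ) := by
    induction μ with
    | nil =>
      have h1 : diagProj S [] = 1 := Subtype.ext (by simp [diagProj, rangeProj])
      rw [h1, map_one]
      simp [rangeProj]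
    | cons i μ ih =>
      have h1 : diagProj S (i :: μ) = diagSandwich hS i (diagProj S μ) :=
        Subtype.ext (rangeProj_cons S i μ)
      rw [h1, hα', rangeProj_cons, map_generator_mul hf, ih]
  let αl : diagonal S →ₗ[ℂ] diagonal S :=
    (α : diagonal S →⋆ₐ[ℂ] diagonal S).toAlgHom.toLinearMap
  exact hF.diagonal_eq_of_rangeProj 0 (f := f.toAlgHom.toLinearMap ∘ₗ ι) (g := ι ∘ₗ αl)
    ((continuous_starAlgHom f).comp continuous_subtype_val)
    (continuous_subtype_val.comp hcontα) (fun μ _ => hP μ)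

/-- The composite is again permutative, with unitary `f v * u`, and agrees with the identity on the
diagonal; rigidity makes it the identity. -/
theorem comp_eq_id [Nontrivial A] (hS : IsCuntzAlgebra S) {f g : A →⋆ₐ[ℂ] A} {u v : A}
    (hu : IsPermUnitary S u) (hv : IsPermUnitary S v) (hf : ∀ i, f (S i) = u * S i)
    (hg : ∀ i, g (S i) = v * S i) (hfg : ∀ x ∈ diagonal S, f (g x) = x) (x : A) :
    f (g x) = x := by
  have h : f.comp g = StarAlgHom.id ℂ A := by
    refine eq_of_eq_on_diagonal hS ((hu.map hS.isCuntzFamily hf hv).mul hS.isCuntzFamily hu)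
      (IsPermUnitary.one S) (fun i => ?_) (fun i => ?_) hfg (fun y hy => ⟨y, hy, hfg y hy⟩)
    · rw [StarAlgHom.comp_apply, hg, map_mul, hf, mul_assoc]
    · rw [one_mul]
      rfl
  exact DFunLike.congr_fun h x

theorem exists_permAutomorphism [Nontrivial A] (hn : 2 ≤ n) (hS : IsCuntzAlgebra S)
    {α : diagonal S ≃⋆ₐ[ℂ] diagonal S} (hα : α ∈ eventuallyCommuting hS) :
    ∃ ρ ∈ permAutomorphisms S, ∀ x : diagonal S, ρ (x : A) = α x := by
  obtain ⟨m, h1, h2⟩ := hα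
  obtain ⟨u, hu, hα⟩ := exists_permUnitary_of_commute hS h2
  obtain ⟨v, hv, hα'⟩ := exists_permUnitary_of_commute hS (α := α⁻¹) (by rwa [inv_inv])
  obtain ⟨f, hf⟩ := hS.exists_endomorphism hn hu.1
  obtain ⟨g, hg⟩ := hS.exists_endomorphism hn hv.1
  have hfg := comp_eq_id hS hu hv hf hg fun x hx => by
    rw [hα' g hg ⟨x, hx⟩, hα f hf, apply_inv_apply]
  have hgf := comp_eq_id hS hv hu hg hf fun x hx => by
    rw [hα f hf ⟨x, hx⟩, hα' g hg, inv_apply_apply]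
  exact ⟨StarAlgEquiv.ofBijective f ⟨Function.LeftInverse.injective hgf,
    Function.RightInverse.surjective hfg⟩, ⟨u, (hS.mem_permUnitaries_iff hn).2 hu, hf⟩, hα f hf⟩

end Extension

/-! ### Restrictions of permutative automorphisms lie in `𝔊`. -/

section Restriction

variable {A : Type*} [CStarAlgebra A] {n : ℕ} {S : Fin n → A}

theorem star_mem_core {x : A} (hx : x ∈ core S) : star x ∈ core S := by
  refine closure_minimal (t := star ⁻¹' core S) ?_ (isClosed_closure.preimage continuous_star) hx
  refine Set.iUnion_subset fun k y hy => subset_closure (Set.mem_iUnion.2 ⟨k, ?_⟩)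
  change star y ∈ matrixLevel S k
  induction hy using Submodule.span_induction with
  | mem y hy =>
    obtain ⟨μ, ν, hμ, hν, rfl⟩ := hy
    rw [star_mul, star_star]
    exact Submodule.subset_span ⟨ν, μ, hν, hμ, rfl⟩
  | zero => simp
  | add y z _ _ h1 h2 => rw [star_add]; exact add_mem h1 h2
  | smul c y _ h => rw [star_smul]; exact Submodule.smul_mem _ _ h

/-- A unitary in the core that maps `φ(𝓓)` into `𝓓` fixes `φᵏ(𝓓)` for large `k`. -/
theorem exists_conj_shift_eq (hS : IsCuntzAlgebra S) {v : A} (hv : v ∈ unitary A)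
    (hcore : v ∈ core S) (hD : ∀ x ∈ diagonal S, v * shift S x * star v ∈ diagonal S) :
    ∃ k, ∀ x ∈ diagonal S, v * (shift S)^[k] x * star v = (shift S)^[k] x := by
  have hF := hS.isCuntzFamily
  obtain ⟨y, hy, hvy⟩ := Metric.mem_closure_iff.1 hcore (1 / 2) (by norm_num)
  obtain ⟨j, hj⟩ := Set.mem_iUnion.1 hy
  -- Raising the level by one puts `φʲ⁺¹(P_μ)` in `φ(𝓓)`, where `hD` applies.
  have hj : y ∈ matrixLevel S (j + 1) := hF.matrixLevel_mono (Nat.le_succ j) hj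
  rw [dist_eq_norm] at hvy
  have hvv := Unitary.star_mul_self_of_mem hv
  have hvv' := Unitary.mul_star_self_of_mem hv
  refine ⟨j + 1, fun x hx => ?_⟩
  let φ : A →ₗ[ℂ] A := ∑ μ : List.Vector (Fin n) (j + 1),
    sandwich (word S μ.toList) (star (word S μ.toList))
  have hφ (x : A) : φ x = (shift S)^[j + 1] x := by
    rw [shift_iterate_eq_sum, LinearMap.sum_apply]
    rfl
  have hφc : Continuous φ := by
    rw [show ⇑φ = (shift S)^[j + 1] from funext hφ]
    refine Continuous.iterate ?_ _
    unfold shift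
    fun_prop
  rw [← hφ]
  refine hF.diagonal_eq 0 (f := sandwich v (star v) ∘ₗ φ) (g := φ)
    ((continuous_sandwich _ _).comp hφc) hφc (fun μ _ => ?_) hx
  change v * φ (rangeProj S μ) * star v = φ (rangeProj S μ)
  rw [hφ]
  set p := (shift S)^[j + 1] (rangeProj S μ) with hp
  have hps : star p = p := by rw [hp, ← shift_iterate_star, star_rangeProj]
  have hpp : p * p = p := by rw [hp, ← hF.shift_iterate_mul, hF.rangeProj_mul_self]
  have hpD : p ∈ diagonal S := hS.shift_iterate_mem_diagonal _ (rangeProj_mem_diagonal S μ)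
  have hvpD : v * p * star v ∈ diagonal S := by
    rw [hp, Function.iterate_succ_apply']
    exact hD _ (hS.shift_iterate_mem_diagonal _ (rangeProj_mem_diagonal S μ))
  refine eq_of_projection_of_norm_sub_lt ?_ ?_ hps hpp (hF.diagonal_commute hvpD hpD) ?_
  · simp only [star_mul, star_star, hps, mul_assoc]
  · calc v * p * star v * (v * p * star v) = v * p * (star v * v) * p * star v := by
          simp only [mul_assoc]
      _ = v * (p * p) * star v := by rw [hvv, mul_one, mul_assoc v]
      _ = v * p * star v := by rw [hpp]
  · have hyp : y * p = p * y := hF.matrixLevel_commute_shift hj _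
    -- Since `y` commutes with `p`, the difference is the commutator of `v - y` with `p`, times
    -- `v^*`. Its norm is at most `2 ‖v - y‖ < 1`, which is why `v` was approximated within `1/2`.
    have h1 : v * p * star v - p = ((v - y) * p - p * (v - y)) * star v := by
      have h2 : (v - y) * p - p * (v - y) = v * p - p * v := by
        rw [sub_mul, mul_sub, hyp, sub_sub_sub_cancel_right]
      rw [h2, sub_mul, mul_assoc p, hvv', mul_one]
    have hnp : ‖p‖ ≤ 1 := norm_le_one_of_projection hps hpp
    have hnv : ‖star v‖ ≤ 1 := norm_le_one_of_star_mul_self (by rw [star_star, hvv'])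
    rw [h1]
    have h3 : ‖(v - y) * p‖ ≤ ‖v - y‖ :=
      (norm_mul_le _ _).trans (mul_le_of_le_one_right (norm_nonneg _) hnp)
    have h4 : ‖p * (v - y)‖ ≤ ‖v - y‖ :=
      (norm_mul_le _ _).trans (mul_le_of_le_one_left (norm_nonneg _) hnp)
    have h5 := (norm_mul_le ((v - y) * p - p * (v - y)) (star v)).trans
      (mul_le_of_le_one_right (norm_nonneg _) hnv)
    have h6 := norm_sub_le ((v - y) * p) (p * (v - y))
    linarith

theorem symm_generator {ρ : A ≃⋆ₐ[ℂ] A} {u : A} (hu : u ∈ unitary A)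
    (hρ : ∀ i, ρ (S i) = u * S i) (i : Fin n) : ρ.symm (S i) = ρ.symm (star u) * S i := by
  rw [StarAlgEquiv.symm_apply_eq, map_mul, StarAlgEquiv.apply_symm_apply, hρ, ← mul_assoc,
    Unitary.star_mul_self_of_mem hu, one_mul]

/-- The element `ρ⁻¹(P_μ)` lies in the core because `ρ` respects the gauge action, and it commutes
with `𝓓` because `ρ(𝓓) ⊆ 𝓓` is commutative with `P_μ`. Maximality of the diagonal in the core
applies. -/
theorem symm_mem_diagonal [Nontrivial A] (hn : 2 ≤ n) (hS : IsCuntzAlgebra S) {ρ : A ≃⋆ₐ[ℂ] A}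
    {u : A} (hu : IsPermUnitary S u) (hρ : ∀ i, ρ (S i) = u * S i) {x : A} (hx : x ∈ diagonal S) :
    ρ.symm x ∈ diagonal S := by
  have hF := hS.isCuntzFamily
  have hucore : u ∈ core S := ((hS.mem_permUnitaries_iff hn).2 hu).2
  refine hF.diagonal_subset 0 (V := (diagonal S).toSubalgebra.toSubmodule.comap
    (ρ.symm : A →⋆ₐ[ℂ] A).toAlgHom.toLinearMap)
    ((isClosed_diagonal S).preimage (continuous_starAlgHom (ρ.symm : A →⋆ₐ[ℂ] A)))
    (fun μ _ => ?_) hx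
  change ρ.symm (rangeProj S μ) ∈ diagonal S
  refine hF.mem_diagonal_of_commute ?_ fun ν => EquivLike.injective ρ ?_
  · refine mem_core_of_map_mem_core hn hS hucore hρ ?_
    rw [StarAlgEquiv.apply_symm_apply]
    exact subset_closure (Set.mem_iUnion.2
      ⟨_, Submodule.subset_span ⟨μ, μ, rfl, rfl, rfl⟩⟩)
  · change ρ _ = ρ _
    rw [map_mul, map_mul, StarAlgEquiv.apply_symm_apply]
    exact hF.diagonal_commute (map_rangeProj_mem_diagonal hS (f := (ρ : A →⋆ₐ[ℂ] A)) hu hρ ν)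
      (rangeProj_mem_diagonal S μ)

/-- The restriction to the diagonal of an automorphism that leaves it invariant. -/
def diagRestrict (ρ : A ≃⋆ₐ[ℂ] A) (h : ∀ x ∈ diagonal S, ρ x ∈ diagonal S)
    (h' : ∀ x ∈ diagonal S, ρ.symm x ∈ diagonal S) : diagonal S ≃⋆ₐ[ℂ] diagonal S where
  toFun x := ⟨ρ x, h x x.2⟩
  invFun x := ⟨ρ.symm x, h' x x.2⟩
  left_inv x := Subtype.ext (ρ.symm_apply_apply x)
  right_inv x := Subtype.ext (ρ.apply_symm_apply x)
  map_mul' x y := Subtype.ext (map_mul ρ (x : A) y)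
  map_add' x y := Subtype.ext (map_add ρ (x : A) y)
  map_star' x := Subtype.ext (map_star ρ (x : A))
  map_smul' c x := Subtype.ext (map_smul ρ c (x : A))

/-- If `ρ (S i) = u S i` and `u` commutes with `φᵐ⁺¹(𝓓)`, then `ρ⁻¹ φᵐ` commutes with `φ` on
`𝓓`. -/
theorem symm_shift_commute (ρ : A ≃⋆ₐ[ℂ] A) {u : A} (hρ : ∀ i, ρ (S i) = u * S i) {m : ℕ} {x : A}
    (hx : u * (shift S)^[m + 1] x * star u = (shift S)^[m + 1] x) :
    ρ.symm ((shift S)^[m + 1] x) = shift S (ρ.symm ((shift S)^[m] x)) := by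
  rw [StarAlgEquiv.symm_apply_eq]
  have h := map_shift (f := (ρ : A →⋆ₐ[ℂ] A)) hρ (ρ.symm ((shift S)^[m] x))
  change ρ _ = u * shift S (ρ _) * star u at h
  rw [h, StarAlgEquiv.apply_symm_apply, ← Function.iterate_succ_apply' (shift S), hx]

/-- Commutation of `ρ⁻¹φᵐ` with `φ` needs `u` to commute with `φᵐ⁺¹(𝓓)`, which holds by its level.
Commutation of `ρφᵐ` needs the same of `v = ρ⁻¹(u^*)`, which is obtained by approximation in the
core. -/
theorem diagRestrict_mem_eventuallyCommuting [Nontrivial A] (hn : 2 ≤ n) (hS : IsCuntzAlgebra S)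
    {ρ : A ≃⋆ₐ[ℂ] A} {u : A} (hu : IsPermUnitary S u) (hρ : ∀ i, ρ (S i) = u * S i)
    (h : ∀ x ∈ diagonal S, ρ x ∈ diagonal S) (h' : ∀ x ∈ diagonal S, ρ.symm x ∈ diagonal S) :
    diagRestrict ρ h h' ∈ eventuallyCommuting hS := by
  have hF := hS.isCuntzFamily
  have hucore : u ∈ core S := ((hS.mem_permUnitaries_iff hn).2 hu).2
  set v := ρ.symm (star u) with hv
  have hρ' := symm_generator hu.1 hρ
  have hvu : v ∈ unitary A := Unitary.map_mem ρ.symm (Unitary.star_mem hu.1)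
  have hvcore : v ∈ core S := by
    refine mem_core_of_map_mem_core hn hS hucore hρ ?_
    rw [hv, StarAlgEquiv.apply_symm_apply]
    exact star_mem_core hucore
  -- Here `v φ(x) v^* = ρ⁻¹(φ(ρ(x)))`, and all three maps preserve the diagonal.
  have hvD (x : A) (hx : x ∈ diagonal S) : v * shift S x * star v ∈ diagonal S := by
    have h1 := map_shift (f := (ρ.symm : A →⋆ₐ[ℂ] A)) hρ' (ρ x)
    change ρ.symm _ = v * shift S (ρ.symm (ρ x)) * star v at h1
    rw [StarAlgEquiv.symm_apply_apply] at h1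
    rw [← h1]
    exact h' _ (shift_mem_diagonal hS (h x hx))
  obtain ⟨k, hk⟩ := exists_conj_shift_eq hS hvu hvcore hvD
  obtain ⟨j, hj⟩ := hu.2
  have hsplit (l : ℕ) (hl : l ≤ max j k + 1) (x : A) :
      (shift S)^[max j k + 1] x = (shift S)^[l] ((shift S)^[max j k + 1 - l] x) := by
    rw [← Function.iterate_add_apply, Nat.add_sub_cancel' hl]
  have hjm : j ≤ max j k + 1 := (le_max_left j k).trans (Nat.le_succ _)
  have hkm : k ≤ max j k + 1 := (le_max_right j k).trans (Nat.le_succ _)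
  refine ⟨max j k, fun x => Subtype.ext ?_, fun x => Subtype.ext ?_⟩
  · change ρ ((diagShift hS)^[max j k] (diagShift hS x) : diagonal S)
      = shift S (ρ ((diagShift hS)^[max j k] x : diagonal S))
    rw [← Function.iterate_succ_apply, coe_diagShift_iterate, coe_diagShift_iterate]
    refine symm_shift_commute ρ.symm hρ' ?_
    rw [hsplit k hkm]
    exact hk _ (hS.shift_iterate_mem_diagonal _ x.2)
  · change ρ.symm ((diagShift hS)^[max j k] (diagShift hS x) : diagonal S)
      = shift S (ρ.symm ((diagShift hS)^[max j k] x : diagonal S))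
    rw [← Function.iterate_succ_apply, coe_diagShift_iterate, coe_diagShift_iterate]
    refine symm_shift_commute ρ hρ ?_
    rw [hsplit j hjm, hF.matrixLevel_commute_shift (permLevel_le_matrixLevel S j hj), mul_assoc,
      Unitary.mul_star_self_of_mem hu.1, mul_one]

end Restriction

/-! ### The restricted Weyl group and the restriction isomorphism. -/

section WeylGroup

variable {A : Type*} [CStarAlgebra A] [Nontrivial A] {n : ℕ} {S : Fin n → A}

theorem exists_restriction (hn : 2 ≤ n) (hS : IsCuntzAlgebra S) {ρ : A ≃⋆ₐ[ℂ] A}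
    (hρ : ρ ∈ permAutomorphisms S) :
    ∃ α ∈ eventuallyCommuting hS, ∀ x : diagonal S, (α x : A) = ρ x := by
  obtain ⟨u, hu, hρ⟩ := hρ
  rw [hS.mem_permUnitaries_iff hn] at hu
  have h (x) (hx : x ∈ diagonal S) : ρ x ∈ diagonal S :=
    map_mem_diagonal hS (f := (ρ : A →⋆ₐ[ℂ] A)) hu hρ hx
  have h' (x) (hx : x ∈ diagonal S) : ρ.symm x ∈ diagonal S := symm_mem_diagonal hn hS hu hρ hx
  exact ⟨_, diagRestrict_mem_eventuallyCommuting hn hS hu hρ h h', fun _ => rfl⟩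

theorem permAutomorphism_ext (hn : 2 ≤ n) (hS : IsCuntzAlgebra S) {ρ ρ' : A ≃⋆ₐ[ℂ] A}
    (hρ : ρ ∈ permAutomorphisms S) (hρ' : ρ' ∈ permAutomorphisms S)
    (h : ∀ x ∈ diagonal S, ρ x = ρ' x) : ρ = ρ' := by
  obtain ⟨α, -, hα⟩ := exists_restriction hn hS hρ
  obtain ⟨u, hu, hρ⟩ := hρ
  obtain ⟨v, hv, hρ'⟩ := hρ'
  rw [hS.mem_permUnitaries_iff hn] at hu hv
  have h1 : (ρ : A →⋆ₐ[ℂ] A) = (ρ' : A →⋆ₐ[ℂ] A) :=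
    eq_of_eq_on_diagonal hS hu hv hρ hρ' h fun y hy =>
      ⟨α⁻¹ ⟨y, hy⟩, (α⁻¹ ⟨y, hy⟩).2, (hα _).symm.trans (by rw [apply_inv_apply])⟩
  exact StarAlgEquiv.ext fun x => DFunLike.congr_fun h1 x

theorem one_mem_permAutomorphisms (hn : 2 ≤ n) (hS : IsCuntzAlgebra S) :
    (1 : A ≃⋆ₐ[ℂ] A) ∈ permAutomorphisms S :=
  ⟨1, (hS.mem_permUnitaries_iff hn).2 (IsPermUnitary.one S), fun i => (one_mul (S i)).symm⟩

theorem mul_mem_permAutomorphisms (hn : 2 ≤ n) (hS : IsCuntzAlgebra S) {ρ ρ' : A ≃⋆ₐ[ℂ] A}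
    (hρ : ρ ∈ permAutomorphisms S) (hρ' : ρ' ∈ permAutomorphisms S) :
    ρ * ρ' ∈ permAutomorphisms S := by
  obtain ⟨u, hu, hρ⟩ := hρ
  obtain ⟨v, hv, hρ'⟩ := hρ'
  rw [hS.mem_permUnitaries_iff hn] at hu hv
  refine ⟨ρ v * u, (hS.mem_permUnitaries_iff hn).2
    ((hu.map hS.isCuntzFamily (f := (ρ : A →⋆ₐ[ℂ] A)) hρ hv).mul hS.isCuntzFamily hu), fun i => ?_⟩
  change ρ (ρ' (S i)) = _
  rw [hρ', map_mul, hρ, mul_assoc]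

/-- That `ρ⁻¹(u^*)` is a sum of words is not evident directly. Instead the inverse of the
restriction is extended to a permutative automorphism, which rigidity identifies with `ρ⁻¹`. -/
theorem inv_mem_permAutomorphisms (hn : 2 ≤ n) (hS : IsCuntzAlgebra S) {ρ : A ≃⋆ₐ[ℂ] A}
    (hρ : ρ ∈ permAutomorphisms S) : ρ⁻¹ ∈ permAutomorphisms S := by
  obtain ⟨α, hα, hαρ⟩ := exists_restriction hn hS hρ
  obtain ⟨ρ', hρ', hαρ'⟩ := exists_permAutomorphism hn hS (inv_mem hα)
  have h : ρ * ρ' = 1 := by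
    refine permAutomorphism_ext hn hS (mul_mem_permAutomorphisms hn hS hρ hρ')
      (one_mem_permAutomorphisms hn hS) fun x hx => ?_
    change ρ (ρ' x) = x
    rw [hαρ' ⟨x, hx⟩, ← hαρ, apply_inv_apply]
  rwa [inv_eq_of_mul_eq_one_right h]

/-- The restricted Weyl group. -/
def restrictedWeylGroup (hn : 2 ≤ n) (hS : IsCuntzAlgebra S) : Subgroup (A ≃⋆ₐ[ℂ] A) where
  carrier := permAutomorphisms S
  mul_mem' := mul_mem_permAutomorphisms hn hS
  one_mem' := one_mem_permAutomorphisms hn hS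
  inv_mem' := inv_mem_permAutomorphisms hn hS

/-- Restriction of permutative automorphisms to the diagonal. -/
def restrictionHom (hn : 2 ≤ n) (hS : IsCuntzAlgebra S) :
    restrictedWeylGroup hn hS →* eventuallyCommuting hS :=
  MonoidHom.mk' (fun ρ => ⟨(exists_restriction hn hS ρ.2).choose,
      (exists_restriction hn hS ρ.2).choose_spec.1⟩) fun ρ ρ' => by
    refine Subtype.ext (StarAlgEquiv.ext fun x => Subtype.ext ?_)
    rw [(exists_restriction hn hS (ρ * ρ').2).choose_spec.2 x]
    change (ρ : A ≃⋆ₐ[ℂ] A) ((ρ' : A ≃⋆ₐ[ℂ] A) x) =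
      ((exists_restriction hn hS ρ.2).choose ((exists_restriction hn hS ρ'.2).choose x) : A)
    rw [(exists_restriction hn hS ρ.2).choose_spec.2, (exists_restriction hn hS ρ'.2).choose_spec.2]

theorem restrictionHom_apply (hn : 2 ≤ n) (hS : IsCuntzAlgebra S) (ρ : restrictedWeylGroup hn hS)
    (x : diagonal S) : ((restrictionHom hn hS ρ : diagonal S ≃⋆ₐ[ℂ] diagonal S) x : A)
      = (ρ : A ≃⋆ₐ[ℂ] A) x :=
  (exists_restriction hn hS ρ.2).choose_spec.2 x

theorem restrictionHom_bijective (hn : 2 ≤ n) (hS : IsCuntzAlgebra S) :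
    Function.Bijective (restrictionHom hn hS) := by
  constructor
  · intro ρ ρ' h
    refine Subtype.ext (permAutomorphism_ext hn hS ρ.2 ρ'.2 fun x hx => ?_)
    rw [← restrictionHom_apply hn hS ρ ⟨x, hx⟩, h, restrictionHom_apply]
  · intro α
    obtain ⟨ρ, hρ, hρα⟩ := exists_permAutomorphism hn hS α.2
    refine ⟨⟨ρ, hρ⟩, Subtype.ext (StarAlgEquiv.ext fun x => Subtype.ext ?_)⟩
    rw [restrictionHom_apply]
    exact hρα x

end WeylGroup

end

end Cuntz

theorem theorem4p1 {A : Type*} [CStarAlgebra A] [Nontrivial A] {n : ℕ} (hn : 2 ≤ n)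
    (S : Fin n → A) (hS : Cuntz.IsCuntzAlgebra S) :
    ∃ W : Subgroup (A ≃⋆ₐ[ℂ] A), (W : Set (A ≃⋆ₐ[ℂ] A)) = Cuntz.permAutomorphisms S ∧
      ∃ r : W ≃* Cuntz.eventuallyCommuting hS,
        ∀ (ρ : W) (x : Cuntz.diagonal S),
          (((r ρ : Cuntz.diagonal S ≃⋆ₐ[ℂ] Cuntz.diagonal S) x : Cuntz.diagonal S) : A)
            = (ρ : A ≃⋆ₐ[ℂ] A) (x : A) :=
  ⟨Cuntz.restrictedWeylGroup hn hS, rfl,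
    MulEquiv.ofBijective (Cuntz.restrictionHom hn hS) (Cuntz.restrictionHom_bijective hn hS),
    Cuntz.restrictionHom_apply hn hS⟩
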